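/- Let $V$ be a finite-dimensional vector space over a field $K$ with $\dim V\ge 1$; write $\langle X\rangle$ for the subspace spanned by $X\subseteq V$. * $E^*(V)$ is the simplicial complex whose simplices are the non-empty finite subsets $X\subset V$ such that, if $0\in X$, then $\langle X\rangle$ is a proper subspace of $V$. * $\Sigma T(V)$ is Quillen's model of the suspension of the Tits building: the simplicial complex whose $p$-simplices are the flags $W_0<\cdots<W_p$ of subspaces of $V$ with $0<W_0$ or $W_p<V$. * $J(V)$ is the poset of proper layers of $V$: pairs $(W_0,W_1)$ of subspaces with $W_0\subseteq W_1$ and $(W_0,W_1)\neq(0,V)$, ordered by $(W_0,W_1)\le(W_0',W_1')$ iff $W_0'\subseteq W_0\subseteq W_1\subseteq W_1'$. For a poset $S$, let $B(S)$ be the simplicial complex of its non-empty finite chains; for a simplicial complex $C$, let $\mathrm{Simpl}(C)$ be the poset of its simplices ordered by inclusion, and let $\mathrm{sd}(C)=B(\mathrm{Simpl}(C))$. A simplicial complex, a poset, or a map of these has a homotopical property if its geometric realisation (with the weak topology) has it; the realisation of a poset $S$ is $|B(S)|$. Then: 1. $E^*(V)$ and $\Sigma T(V)$ are homotopy equivalent;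 2. $E^*(V)$ and $J(V)$ are homotopy equivalent; 3. the order-preserving map $\mathrm{Simpl}(\mathrm{sd}\,E^*(V))\to J(V)$, $(X_0<\cdots<X_p)\mapsto(\langle X_0\rangle,\langle X_p\rangle)$, is a homotopy equivalence. -/

import Mathlib

noncomputable section

/-! ### Geometric realisation of abstract simplicial complexes -/

/-- The points of the geometric realisation `|C|`: functions on the vertices with values in
`[0, 1]`, of sum one, whose support is a simplex of `C`. -/
def Realization {ι : Type*} (C : AbstractSimplicialComplex ι) : Type _ :=
  {x : ι →₀ ℝ // (∀ i, 0 ≤ x i) ∧ x.support ∈ C ∧ (x.sum fun _ a => a) = 1}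

/-- The closed face `|s|` of `|C|`: the points whose support is contained in `s`. -/
def Realization.face {ι : Type*} (C : AbstractSimplicialComplex ι) (s : Finset ι) :
    Set (Realization C) :=
  {x | x.1.support ⊆ s}

/-- The coherent (weak) topology on `|C|`: a set is open iff its trace on every closed face `|s|`,
`s` a simplex, is open for the Euclidean topology of `|s|` (that of the barycentric
coordinates). -/
instance Realization.instTopologicalSpace {ι : Type*} (C : AbstractSimplicialComplex ι) :
    TopologicalSpace (Realization C) :=
  ⨆ s : {s : Finset ι // s ∈ C},
    TopologicalSpace.coinduced (Subtype.val : Realization.face C s.1 → Realization C)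
      (TopologicalSpace.induced (fun x (i : ι) => x.1.1 i) Pi.topologicalSpace)

theorem Realization.support_mapDomain {ι κ : Type*} [DecidableEq κ] (f : ι → κ) (x : ι →₀ ℝ)
    (hx : ∀ i, 0 ≤ x i) : (Finsupp.mapDomain f x).support = x.support.image f := by
  refine (Finsupp.mapDomain_support).antisymm ?_
  intro j hj
  obtain ⟨i, hi, rfl⟩ := Finset.mem_image.1 hj
  have hpos : 0 < x i := lt_of_le_of_ne (hx i) (Ne.symm (Finsupp.mem_support_iff.1 hi))
  rw [Finsupp.mem_support_iff, Finsupp.mapDomain, Finsupp.sum_apply, Finsupp.sum]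
  refine (lt_of_lt_of_le hpos ?_).ne'
  calc x i = Finsupp.single (f i) (x i) (f i) := by simp
    _ ≤ _ := Finset.single_le_sum (f := fun k => Finsupp.single (f k) (x k) (f i))
      (fun k _ => by
        by_cases h : f k = f i
        · simp [h, hx k]
        · simp [Finsupp.single_eq_of_ne (Ne.symm h)]) hi

theorem Realization.mapDomain_nonneg {ι κ : Type*} (f : ι → κ) (x : ι →₀ ℝ)
    (hx : ∀ i, 0 ≤ x i) (j : κ) : 0 ≤ Finsupp.mapDomain f x j := by
  rw [Finsupp.mapDomain, Finsupp.sum_apply, Finsupp.sum]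
  refine Finset.sum_nonneg fun k _ => ?_
  by_cases h : f k = j
  · simp [h, hx k]
  · simp [Finsupp.single_eq_of_ne (Ne.symm h)]

open Classical in
/-- A simplicial map of abstract simplicial complexes: a map of vertices that sends simplices to
simplices. -/
def IsSimplicialMap {ι κ : Type*} (C : AbstractSimplicialComplex ι)
    (D : AbstractSimplicialComplex κ) (f : ι → κ) : Prop :=
  ∀ s ∈ C, s.image f ∈ D

/-- The map `|f| : |C| → |D|` underlying the realisation of a simplicial map; it is affine on
each simplex: `|f|(x)(w) = ∑_{f(v) = w} x(v)`. -/
def Realization.mapFun {ι κ : Type*} {C : AbstractSimplicialComplex ι}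
    {D : AbstractSimplicialComplex κ} (f : ι → κ) (hf : IsSimplicialMap C D f)
    (x : Realization C) : Realization D :=
  ⟨Finsupp.mapDomain f x.1, Realization.mapDomain_nonneg f x.1 x.2.1, by
    classical
    rw [Realization.support_mapDomain f x.1 x.2.1]
    convert hf _ x.2.2.1, by
    rw [Finsupp.sum_mapDomain_index (fun _ => rfl) (fun _ _ _ => rfl)]
    exact x.2.2.2⟩

theorem Realization.continuous_mapFun {ι κ : Type*} {C : AbstractSimplicialComplex ι}
    {D : AbstractSimplicialComplex κ} (f : ι → κ) (hf : IsSimplicialMap C D f) :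
    Continuous (Realization.mapFun (C := C) (D := D) f hf) := by
  classical
  refine continuous_iSup_dom.2 fun s => continuous_coinduced_dom.2 ?_
  have ht : s.1.image f ∈ D := by convert hf _ s.2
  let g : Realization.face C s.1 → Realization.face D (s.1.image f) := fun x =>
    ⟨Realization.mapFun f hf x.1, by
      change (Finsupp.mapDomain f x.1.1).support ⊆ _
      rw [Realization.support_mapDomain f x.1.1 x.1.2.1]
      exact Finset.image_subset_image x.2⟩
  let τ : TopologicalSpace (Realization.face C s.1) :=
    TopologicalSpace.induced (fun x (i : ι) => x.1.1 i) Pi.topologicalSpace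
  let σ : TopologicalSpace (Realization.face D (s.1.image f)) :=
    TopologicalSpace.induced (fun x (i : κ) => x.1.1 i) Pi.topologicalSpace
  have hval : Continuous (Subtype.val : Realization.face D (s.1.image f) → Realization D) :=
    continuous_iff_coinduced_le.2
      (le_iSup (fun s : {s : Finset κ // s ∈ D} =>
        TopologicalSpace.coinduced (Subtype.val : Realization.face D s.1 → Realization D)
          (TopologicalSpace.induced (fun x (i : κ) => x.1.1 i) Pi.topologicalSpace))
        ⟨s.1.image f, ht⟩)
  have hg : Continuous g := by
    refine continuous_induced_rng.2 (continuous_pi fun j => ?_)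
    have key : ∀ x : Realization.face C s.1, Finsupp.mapDomain f x.1.1 j =
        ∑ i ∈ s.1, if f i = j then x.1.1 i else 0 := by
      intro x
      rw [Finsupp.mapDomain, Finsupp.sum_apply,
        Finsupp.sum_of_support_subset _ x.2 _ (by simp)]
      refine Finset.sum_congr rfl fun i _ => ?_
      rw [Finsupp.single_apply]
    change Continuous fun x : Realization.face C s.1 => Finsupp.mapDomain f x.1.1 j
    simp only [key]
    refine continuous_finsetSum _ fun i _ => ?_
    split_ifs
    · exact (continuous_apply i).comp continuous_induced_dom
    · exact continuous_const
  exact hval.comp hg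

/-- The realisation `|f| : |C| → |D|` of a simplicial map. -/
def Realization.map {ι κ : Type*} {C : AbstractSimplicialComplex ι}
    {D : AbstractSimplicialComplex κ} (f : ι → κ) (hf : IsSimplicialMap C D f) :
    C(Realization C, Realization D) :=
  ⟨Realization.mapFun f hf, Realization.continuous_mapFun f hf⟩

/-- A continuous map is a homotopy equivalence. -/
def IsHomotopyEquivalence {X Y : Type*} [TopologicalSpace X] [TopologicalSpace Y]
    (f : C(X, Y)) : Prop :=
  ∃ e : ContinuousMap.HomotopyEquiv X Y, e.toFun = f

/-- Two spaces are homotopy equivalent. -/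
def HomotopyEquivalent (X Y : Type*) [TopologicalSpace X] [TopologicalSpace Y] : Prop :=
  Nonempty (ContinuousMap.HomotopyEquiv X Y)

/-! ### Posets and simplicial complexes -/

/-- The order complex `B(S)` of a poset `S`: its simplices are the totally ordered nonempty finite
subsets of `S`. -/
def orderComplex (S : Type*) [PartialOrder S] : AbstractSimplicialComplex S where
  faces := {c | c.Nonempty ∧ IsChain (· ≤ ·) (c : Set S)}
  isRelLowerSet_faces := fun _ hs =>
    ⟨hs.1, fun _ hts ht => ⟨ht, hs.2.mono (Finset.coe_subset.2 hts)⟩⟩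
  singleton_mem v := ⟨Finset.singleton_nonempty v, by simp⟩

/-- The poset `Simpl(C)` of simplices of a simplicial complex `C`, ordered by inclusion. -/
abbrev SimplexPoset {ι : Type*} (C : AbstractSimplicialComplex ι) : Type _ :=
  {s : Finset ι // s ∈ C}

/-- The barycentric subdivision `sd(C) = B(Simpl(C))`. -/
abbrev barycentricSubdivision {ι : Type*} (C : AbstractSimplicialComplex ι) :
    AbstractSimplicialComplex (SimplexPoset C) :=
  orderComplex (SimplexPoset C)

theorem isSimplicialMap_of_monotone {S T : Type*} [PartialOrder S] [PartialOrder T] (f : S → T)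
    (hf : Monotone f) : IsSimplicialMap (orderComplex S) (orderComplex T) f := by
  classical
  rintro c ⟨hne, hc⟩
  refine ⟨hne.image _, ?_⟩
  rw [Finset.coe_image]
  rintro _ ⟨a, ha, rfl⟩ _ ⟨b, hb, rfl⟩ _
  exact (hc.total ha hb).imp (fun h => hf h) (fun h => hf h)

/-- The realisation `|B(f)| : |B(S)| → |B(T)|` of an order-preserving map of posets. -/
def posetRealizationMap {S T : Type*} [PartialOrder S] [PartialOrder T] (f : S →o T) :
    C(Realization (orderComplex S), Realization (orderComplex T)) :=
  Realization.map f (isSimplicialMap_of_monotone f f.monotone)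

/-! ### The complex `E^*(V)`, the suspended Tits building and the proper layers -/

/-- The simplicial complex `E^*(V)`: its simplices are the nonempty finite subsets `X` of `V` such
that if `0 ∈ X`, then `X` spans a proper subspace. -/
def EStar (K V : Type*) [Field K] [AddCommGroup V] [Module K V] [Nontrivial V] :
    AbstractSimplicialComplex V where
  faces := {X | X.Nonempty ∧ (0 ∈ X → Submodule.span K (X : Set V) < ⊤)}
  isRelLowerSet_faces := fun _ hs =>
    ⟨hs.1, fun _ hts ht =>
      ⟨ht, fun h0 => lt_of_le_of_lt (Submodule.span_mono (Finset.coe_subset.2 hts))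
        (hs.2 (hts h0))⟩⟩
  singleton_mem v := ⟨Finset.singleton_nonempty v, fun h => by
    rw [Finset.mem_singleton] at h
    subst h
    rw [Finset.coe_singleton, Submodule.span_zero_singleton]
    exact bot_lt_top⟩

/-- Quillen's suspension `ΣT(V)` of the Tits building: its simplices are the flags
`W₀ < ⋯ < W_p` of subspaces of `V` with `0 < W₀` or `W_p < V`, that is, the nonempty finite
chains of subspaces that do not contain both `0` and `V`. -/
def suspendedTitsBuilding (K V : Type*) [Field K] [AddCommGroup V] [Module K V] [Nontrivial V] :
    AbstractSimplicialComplex (Submodule K V) where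
  faces := {c | c.Nonempty ∧ IsChain (· ≤ ·) (c : Set (Submodule K V)) ∧
    ((∀ W ∈ c, ⊥ < W) ∨ ∀ W ∈ c, W < ⊤)}
  isRelLowerSet_faces := fun _ hs =>
    ⟨hs.1, fun _ hts ht => ⟨ht, hs.2.1.mono (Finset.coe_subset.2 hts),
      hs.2.2.imp (fun h W hW => h W (hts hW)) (fun h W hW => h W (hts hW))⟩⟩
  singleton_mem v := by
    refine ⟨Finset.singleton_nonempty v, by simp, ?_⟩
    by_cases h : v = ⊤
    · exact Or.inl (by simp [h])
    · exact Or.inr (by simpa using Ne.lt_top h)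

/-- A proper layer of `V`: a pair `W₀ ≤ W₁` of subspaces other than the pair `(0, V)`. -/
@[ext]
structure ProperLayer (K V : Type*) [Field K] [AddCommGroup V] [Module K V] where
  lower : Submodule K V
  upper : Submodule K V
  lower_le_upper : lower ≤ upper
  proper : ¬(lower = ⊥ ∧ upper = ⊤)

/-- The order on the set `J(V)` of proper layers: `(W₀, W₁) ≤ (W₀', W₁')` iff
`W₀' ≤ W₀ ≤ W₁ ≤ W₁'`. -/
instance ProperLayer.instPartialOrder (K V : Type*) [Field K] [AddCommGroup V] [Module K V] :
    PartialOrder (ProperLayer K V) where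
  le a b := b.lower ≤ a.lower ∧ a.upper ≤ b.upper
  le_refl _ := ⟨le_rfl, le_rfl⟩
  le_trans _ _ _ h h' := ⟨h'.1.trans h.1, h.2.trans h'.2⟩
  le_antisymm _ _ h h' := ProperLayer.ext (le_antisymm h'.1 h.1) (le_antisymm h.2 h'.2)

/-- The subspace of `V` spanned by a simplex of `E^*(V)`. -/
def simplexSpan {K V : Type*} [Field K] [AddCommGroup V] [Module K V] [Nontrivial V]
    (X : SimplexPoset (EStar K V)) : Submodule K V :=
  Submodule.span K (X.1 : Set V)

theorem simplexSpan_mono {K V : Type*} [Field K] [AddCommGroup V] [Module K V] [Nontrivial V] :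
    Monotone (simplexSpan (K := K) (V := V)) :=
  fun _ _ h => Submodule.span_mono (Finset.coe_subset.2 h)

/-- A nonempty finite chain has a least element. -/
theorem exists_isLeast_of_mem_orderComplex {S : Type*} [PartialOrder S] (c : Finset S)
    (hc : c ∈ orderComplex S) : ∃ a, IsLeast (c : Set S) a := by
  obtain ⟨a, ha⟩ := c.exists_minimal hc.1
  exact ⟨a, ha.1, fun b hb => (hc.2.total ha.1 hb).elim id fun h => ha.2 hb h⟩

/-- A nonempty finite chain has a greatest element. -/
theorem exists_isGreatest_of_mem_orderComplex {S : Type*} [PartialOrder S] (c : Finset S)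
    (hc : c ∈ orderComplex S) : ∃ a, IsGreatest (c : Set S) a := by
  obtain ⟨a, ha⟩ := c.exists_maximal hc.1
  exact ⟨a, ha.1, fun b hb => (hc.2.total ha.1 hb).elim (fun h => ha.2 hb h) id⟩

/-- The least element `X₀` of a simplex `X₀ < ⋯ < X_p` of an order complex. -/
def chainMin {S : Type*} [PartialOrder S] (c : SimplexPoset (orderComplex S)) : S :=
  (exists_isLeast_of_mem_orderComplex c.1 c.2).choose

/-- The greatest element `X_p` of a simplex `X₀ < ⋯ < X_p` of an order complex. -/
def chainMax {S : Type*} [PartialOrder S] (c : SimplexPoset (orderComplex S)) : S :=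
  (exists_isGreatest_of_mem_orderComplex c.1 c.2).choose

theorem isLeast_chainMin {S : Type*} [PartialOrder S] (c : SimplexPoset (orderComplex S)) :
    IsLeast (c.1 : Set S) (chainMin c) :=
  (exists_isLeast_of_mem_orderComplex c.1 c.2).choose_spec

theorem isGreatest_chainMax {S : Type*} [PartialOrder S] (c : SimplexPoset (orderComplex S)) :
    IsGreatest (c.1 : Set S) (chainMax c) :=
  (exists_isGreatest_of_mem_orderComplex c.1 c.2).choose_spec

/-- The order-preserving map `Simpl(sd E^*(V)) → J(V)`,
`(X₀ < ⋯ < X_p) ↦ (⟨X₀⟩, ⟨X_p⟩)`. -/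
def layerMap (K V : Type*) [Field K] [AddCommGroup V] [Module K V] [Nontrivial V] :
    SimplexPoset (barycentricSubdivision (EStar K V)) →o ProperLayer K V where
  toFun c :=
    { lower := simplexSpan (chainMin c)
      upper := simplexSpan (chainMax c)
      lower_le_upper := simplexSpan_mono ((isLeast_chainMin c).2 (isGreatest_chainMax c).1)
      proper := by
        rintro ⟨h0, h1⟩
        obtain ⟨v, hv⟩ := (chainMin c).2.1
        have hv0 : v = 0 :=
          Submodule.span_eq_bot.1 h0 v (Finset.mem_coe.2 hv)
        subst hv0
        have hmem : (0 : V) ∈ (chainMax c).1 :=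
          (isLeast_chainMin c).2 (isGreatest_chainMax c).1 hv
        exact ((chainMax c).2.2 hmem).ne h1 }
  monotone' a b hab :=
    ⟨simplexSpan_mono ((isLeast_chainMin b).2 (hab (isLeast_chainMin a).1)),
      simplexSpan_mono ((isGreatest_chainMax b).2 (hab (isGreatest_chainMax a).1))⟩

end

noncomputable section

open Topology Set unitInterval

namespace AbstractSimplicialComplex

variable {ι : Type*}

/-! Both $E^*(V)$ and $\Sigma T(V)$ are compared with $J(V)$ by Quillen's fibre lemma: an
order-preserving map $f$ is a homotopy equivalence if every $\{p : f(p)\le q\}$ is contractible. For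
`layerMap` over $q=(W_0,W_1)$, the fibre consists of the chains of simplices $X$ with $W_0\le\langle
X\rangle\le W_1$. Finite dimension gives a finite simplex $Y$ spanning $W_0$; since $q\ne(0,V)$, $0$
can be put into $Y$ or left out so that $X\cup Y$ is always a simplex. Then $X\subseteq X\cup
Y\supseteq Y$ contracts the poset of these $X$, hence its subdivision. For `flagMap` the fibre
consists of the flags in the interval $[W_0,W_1]$, which has a least element. Subdivision invariance
then links the three spaces.

The topological input is a contractible carrier lemma for order complexes
(`exists_extension_of_contractible`, `homotopic_of_contractible_carrier`): maps are built by coning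
off along the largest vertex. It yields the fibre lemma and half of the subdivision theorem; the
other half is a straight-line homotopy. -/

theorem mem_of_subset (C : AbstractSimplicialComplex ι) {s t : Finset ι} (hs : s ∈ C)
    (hts : t ⊆ s) (ht : t.Nonempty) : t ∈ C :=
  (C.isRelLowerSet_faces hs).2 hts ht

theorem nonempty_of_mem (C : AbstractSimplicialComplex ι) {s : Finset ι} (hs : s ∈ C) :
    s.Nonempty :=
  (C.isRelLowerSet_faces hs).1

end AbstractSimplicialComplex

theorem ContinuousMap.homotopic_of_continuous {X Y : Type*} [TopologicalSpace X]
    [TopologicalSpace Y] {f g : C(X, Y)} (G : C(X × I, Y)) (h0 : ∀ x, G (x, 0) = f x)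
    (h1 : ∀ x, G (x, 1) = g x) : f.Homotopic g :=
  ⟨{ toContinuousMap := G.comp ⟨Prod.swap, continuous_swap⟩
     map_zero_left := h0
     map_one_left := h1 }⟩

/-! ### Topology of the realisation and straight-line homotopies -/

namespace Realization

variable {ι : Type*} {C : AbstractSimplicialComplex ι}

@[ext]
theorem ext {x y : Realization C} (h : ∀ i, x.1 i = y.1 i) : x = y :=
  Subtype.ext (Finsupp.ext h)

theorem nonneg (x : Realization C) (i : ι) : 0 ≤ x.1 i := x.2.1 i

theorem support_mem (x : Realization C) : x.1.support ∈ C := x.2.2.1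

theorem mem_face_support (x : Realization C) : x ∈ face C x.1.support :=
  Finset.Subset.refl _

theorem eq_zero_of_mem_face {s : Finset ι} {x : Realization C} (hx : x ∈ face C s) {i : ι}
    (hi : i ∉ s) : x.1 i = 0 := by
  by_contra h
  exact hi (hx (Finsupp.mem_support_iff.2 h))

theorem face_mono {s t : Finset ι} (h : s ⊆ t) : face C s ⊆ face C t :=
  fun _ hx => Finset.Subset.trans hx h

theorem sum_eq_one {s : Finset ι} {x : Realization C} (hx : x ∈ face C s) :
    ∑ i ∈ s, x.1 i = 1 :=
  (Finsupp.sum_of_support_subset _ hx _ (by simp)).symm.trans x.2.2.2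

theorem le_one (x : Realization C) (i : ι) : x.1 i ≤ 1 := by
  by_cases hi : i ∈ x.1.support
  · exact (Finset.single_le_sum (fun j _ => x.nonneg j) hi).trans
      (sum_eq_one x.mem_face_support).le
  · rw [Finsupp.notMem_support_iff.1 hi]
    exact zero_le_one

theorem continuous_coord (i : ι) : Continuous fun x : Realization C => x.1 i :=
  continuous_iSup_dom.2 fun s => continuous_coinduced_dom.2 <| by
    let τ : TopologicalSpace (face C s.1) :=
      TopologicalSpace.induced (fun x (i : ι) => x.1.1 i) Pi.topologicalSpace
    have h : Continuous fun (x : face C s.1) (i : ι) => x.1.1 i := continuous_induced_dom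
    exact (continuous_apply i).comp h

/-- The coordinates are globally continuous, and the weak topology makes each Euclidean face map
continuously into $|C|$; so the two topologies on a face agree. -/
theorem isInducing_coord_face {s : Finset ι} (hs : s ∈ C) :
    IsInducing fun (x : face C s) (i : ι) => x.1.1 i := by
  constructor
  apply le_antisymm
  · exact continuous_iff_le_induced.1
      (continuous_pi fun i => (continuous_coord i).comp continuous_subtype_val)
  · exact coinduced_le_iff_le_induced.1 (le_iSup (fun s : {s : Finset ι // s ∈ C} =>
        TopologicalSpace.coinduced (Subtype.val : Realization.face C s.1 → Realization C)
          (TopologicalSpace.induced (fun x (i : ι) => x.1.1 i) Pi.topologicalSpace)) ⟨s, hs⟩)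

theorem continuousOn_of_coord_of_mem {Z : Type*} [TopologicalSpace Z] {g : Z → Realization C} {A : Set Z}
    {s : Finset ι} (hs : s ∈ C) (hg : ∀ z ∈ A, g z ∈ face C s)
    (h : ∀ i, ContinuousOn (fun z => (g z).1 i) A) : ContinuousOn g A := by
  rw [continuousOn_iff_continuous_domRestrict]
  have : Continuous fun z : A => (⟨g z.1, hg z.1 z.2⟩ : face C s) :=
    (isInducing_coord_face hs).continuous_iff.2
      (continuous_pi fun i => (h i).domRestrict)
  exact continuous_subtype_val.comp this

/-- Here `T` need not be a simplex: the finitely many simplices inside `T` have relatively closed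
preimages covering `A`, and continuity is pasted. -/
theorem continuousOn_of_coord {Z : Type*} [TopologicalSpace Z] {g : Z → Realization C} {A : Set Z}
    {T : Finset ι} (hg : ∀ z ∈ A, g z ∈ face C T)
    (h : ∀ i, ContinuousOn (fun z => (g z).1 i) A) : ContinuousOn g A := by
  rw [continuousOn_iff_continuous_domRestrict]
  let F : {s : Finset ι // s ⊆ T ∧ s ∈ C} → Set A := fun s => {z | g z ∈ face C s.1}
  have : Finite {s : Finset ι // s ⊆ T ∧ s ∈ C} :=
    (T.powerset.finite_toSet.subset fun s hs => Finset.mem_coe.2 (Finset.mem_powerset.2 hs.1))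
  refine (locallyFinite_of_finite F).continuous ?_ (fun s => ?_) fun s => ?_
  · refine eq_univ_of_forall fun z => mem_iUnion.2
      ⟨⟨(g z).1.support, hg z z.2, (g z).support_mem⟩, (g z).mem_face_support⟩
  · have : F s = ⋂ i, ⋂ (_ : i ∉ s.1), {z : A | (g z).1 i = 0} := by
      ext z
      simp only [mem_iInter]
      refine ⟨fun hz i hi => eq_zero_of_mem_face hz hi, fun hz i hi => ?_⟩
      by_contra his
      exact Finsupp.mem_support_iff.1 hi (hz i his)
    rw [this]
    exact isClosed_iInter fun i => isClosed_iInter fun _ =>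
      isClosed_eq (h i).domRestrict continuous_const
  · exact continuousOn_of_coord_of_mem s.2.2 (fun z hz => hz)
      fun i => (h i).domRestrict.continuousOn

theorem continuous_of_face {Z : Type*} [TopologicalSpace Z] {f : Realization C → Z}
    (h : ∀ s ∈ C, ContinuousOn f (face C s)) : Continuous f := by
  refine continuous_iSup_dom.2 fun s => continuous_coinduced_dom.2 ?_
  have := (h s.1 s.2).domRestrict
  rw [continuous_def] at this ⊢
  intro U hU
  have := this U hU
  rwa [(isInducing_coord_face s.2).eq_induced] at this

/-- Currying into `C(I, Z)` reduces this to continuity on $|C|$, so the topology of $|C|\times I$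
need not be analysed. -/
theorem continuous_prod_of_face {Z : Type*} [TopologicalSpace Z] {f : Realization C × I → Z}
    (h : ∀ s ∈ C, ContinuousOn f (face C s ×ˢ univ)) : Continuous f := by
  let F : Realization C → C(I, Z) := fun x => ⟨fun t => f (x, t),
    (h _ x.support_mem).comp_continuous (by fun_prop) fun t => ⟨x.mem_face_support, mem_univ _⟩⟩
  have hF : Continuous F := by
    refine continuous_of_face fun s hs => ?_
    rw [continuousOn_iff_continuous_domRestrict]
    refine ContinuousMap.continuous_of_continuous_uncurry _ ?_
    exact (h s hs).comp_continuous (f := fun p : face C s × I => (p.1.1, p.2))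
      (by fun_prop) fun p => ⟨p.1.2, mem_univ _⟩
  exact ContinuousMap.continuous_uncurry_of_continuous ⟨F, hF⟩

theorem isCompact_face {s : Finset ι} (hs : s ∈ C) : IsCompact (face C s) := by
  rw [isCompact_iff_isCompact_univ, (isInducing_coord_face hs).isCompact_iff]
  have hK : IsCompact (Set.pi univ fun _ : ι => Icc (0 : ℝ) 1) :=
    isCompact_univ_pi fun _ => isCompact_Icc
  have hcl : IsClosed {w : ι → ℝ | (∀ i, i ∉ s → w i = 0) ∧ ∑ i ∈ s, w i = 1} := by
    simp only [ofPred_and, ofPred_forall]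
    refine IsClosed.inter (isClosed_iInter fun i => isClosed_iInter fun _ => ?_) ?_
    · exact isClosed_eq (continuous_apply i) continuous_const
    · exact isClosed_eq (by fun_prop) continuous_const
  convert hK.inter_right hcl using 1
  ext w
  constructor
  · rintro ⟨x, -, rfl⟩
    exact ⟨fun i _ => ⟨x.1.nonneg i, x.1.le_one i⟩,
      fun i hi => eq_zero_of_mem_face x.2 hi, sum_eq_one x.2⟩
  · rintro ⟨h01, h0, h1⟩
    classical
    let v : ι →₀ ℝ := Finsupp.onFinset s w fun i hi => by
      by_contra h
      exact hi (h0 i h)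
    have hv : v.support ⊆ s := Finsupp.support_onFinset_subset
    have hsum : (v.sum fun _ a => a) = 1 := by
      rw [Finsupp.sum_of_support_subset _ hv _ (by simp)]
      exact h1
    have hne : v.support.Nonempty := by
      rw [Finset.nonempty_iff_ne_empty]
      intro h
      rw [Finsupp.sum, h] at hsum
      simp at hsum
    exact ⟨⟨⟨v, fun i => (h01 i (mem_univ _)).1, C.mem_of_subset hs hv hne, hsum⟩, hv⟩,
      mem_univ _, rfl⟩

/-- The point of `|C|` given by barycentric coordinates supported in a simplex. -/
def ofSubset (w : ι →₀ ℝ) (h0 : ∀ i, 0 ≤ w i) (h1 : (w.sum fun _ a => a) = 1)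
    (h : ∃ s ∈ C, w.support ⊆ s) : Realization C :=
  ⟨w, h0, by
    obtain ⟨s, hs, hws⟩ := h
    refine C.mem_of_subset hs hws ?_
    rw [Finset.nonempty_iff_ne_empty]
    intro h
    rw [Finsupp.sum, h] at h1
    simp at h1, h1⟩

open Classical in
/-- The point at time `t` of the straight segment joining two points of a common closed face. -/
def segment (x y : Realization C) (h : ∃ s ∈ C, x ∈ face C s ∧ y ∈ face C s) (t : I) :
    Realization C :=
  ofSubset ((1 - t : ℝ) • x.1 + (t : ℝ) • y.1)
    (fun i => add_nonneg (mul_nonneg (sub_nonneg.2 t.2.2) (x.nonneg i))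
      (mul_nonneg t.2.1 (y.nonneg i)))
    (by
      rw [Finsupp.sum_add_index' (by simp) (by simp), Finsupp.sum_smul_index' (by simp),
        Finsupp.sum_smul_index' (by simp)]
      have hx := x.2.2.2
      have hy := y.2.2.2
      simp only [Finsupp.sum, smul_eq_mul, ← Finset.mul_sum] at hx hy ⊢
      rw [hx, hy]
      ring)
    (by
      obtain ⟨s, hs, hx, hy⟩ := h
      exact ⟨s, hs, Finsupp.support_add.trans (Finset.union_subset
        (Finsupp.support_smul.trans hx) (Finsupp.support_smul.trans hy))⟩)

theorem segment_apply (x y : Realization C) (h) (t : I) (i : ι) :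
    (segment x y h t).1 i = (1 - t) * x.1 i + t * y.1 i := rfl

theorem segment_mem_face {x y : Realization C} (h) (t : I) {s : Finset ι} (hx : x ∈ face C s)
    (hy : y ∈ face C s) : segment x y h t ∈ face C s := by
  intro i hi
  by_contra his
  refine Finsupp.mem_support_iff.1 hi ?_
  rw [segment_apply, eq_zero_of_mem_face hx his, eq_zero_of_mem_face hy his]
  ring

theorem homotopic_of_common_face {κ : Type*} {D : AbstractSimplicialComplex κ}
    (f g : C(Realization C, Realization D))
    (h : ∀ s ∈ C, ∃ t ∈ D, ∀ x ∈ face C s, f x ∈ face D t ∧ g x ∈ face D t) :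
    f.Homotopic g := by
  have h' : ∀ x, ∃ t ∈ D, f x ∈ face D t ∧ g x ∈ face D t := fun x => by
    obtain ⟨t, ht, hx⟩ := h _ x.support_mem
    exact ⟨t, ht, hx x x.mem_face_support⟩
  have hG : Continuous fun p : Realization C × I => segment (f p.1) (g p.1) (h' p.1) p.2 := by
    refine continuous_prod_of_face fun s hs => ?_
    obtain ⟨t, ht, hx⟩ := h s hs
    refine continuousOn_of_coord (T := t)
      (fun p hp => segment_mem_face _ _ (hx _ hp.1).1 (hx _ hp.1).2) fun i => ?_
    simp only [segment_apply]
    have hf : Continuous fun p : Realization C × I => (f p.1).1 i :=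
      (continuous_coord i).comp (f.continuous.comp continuous_fst)
    have hg : Continuous fun p : Realization C × I => (g p.1).1 i :=
      (continuous_coord i).comp (g.continuous.comp continuous_fst)
    have ht : Continuous fun p : Realization C × I => (p.2 : ℝ) :=
      continuous_subtype_val.comp continuous_snd
    exact (((continuous_const.sub ht).mul hf).add (ht.mul hg)).continuousOn
  refine ContinuousMap.homotopic_of_continuous ⟨_, hG⟩ (fun x => ?_) fun x => ?_
  · ext i
    refine (segment_apply (f x) (g x) (h' x) 0 i).trans ?_
    simp
  · ext i
    refine (segment_apply (f x) (g x) (h' x) 1 i).trans ?_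
    simp

theorem sum_pos_of_support_mem (w : ι →₀ ℝ) (h0 : ∀ i, 0 ≤ w i) (h : w.support ∈ C) :
    0 < w.sum fun _ a => a :=
  Finset.sum_pos (fun i hi => lt_of_le_of_ne (h0 i) (Ne.symm (Finsupp.mem_support_iff.1 hi)))
    (C.nonempty_of_mem h)

/-- The point of `|C|` proportional to a non-negative function supported on a simplex. -/
def normalize (w : ι →₀ ℝ) (h0 : ∀ i, 0 ≤ w i) (h : w.support ∈ C) : Realization C :=
  ofSubset ((w.sum fun _ a => a)⁻¹ • w)
    (fun i => mul_nonneg (inv_nonneg.2 (sum_pos_of_support_mem w h0 h).le) (h0 i))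
    (by
      rw [Finsupp.sum_smul_index' (by simp)]
      have := sum_pos_of_support_mem w h0 h
      simp only [Finsupp.sum, smul_eq_mul, ← Finset.mul_sum] at this ⊢
      exact inv_mul_cancel₀ this.ne')
    ⟨w.support, h, Finsupp.support_smul⟩

theorem support_normalize (w : ι →₀ ℝ) (h0) (h : w.support ∈ C) :
    (normalize w h0 h).1.support = w.support :=
  Finsupp.support_smul_eq (inv_ne_zero (sum_pos_of_support_mem w h0 h).ne')

theorem normalize_apply (w : ι →₀ ℝ) (h0) (h : w.support ∈ C) {s : Finset ι}
    (hs : w.support ⊆ s) (i : ι) : (normalize w h0 h).1 i = (∑ j ∈ s, w j)⁻¹ * w i := by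
  rw [← Finsupp.sum_of_support_subset w hs (fun _ a => a) (by simp)]
  rfl

theorem continuousOn_normalize {Z : Type*} [TopologicalSpace Z] {A : Set Z} {s : Finset ι}
    (w : Z → ι →₀ ℝ) (h0 : ∀ z i, 0 ≤ w z i) (h : ∀ z, (w z).support ∈ C)
    (hws : ∀ z ∈ A, (w z).support ⊆ s) (hc : ∀ i, ContinuousOn (fun z => w z i) A) :
    ContinuousOn (fun z => normalize (w z) (h0 z) (h z)) A := by
  refine continuousOn_of_coord (T := s) (fun z hz => ?_) fun i => ?_
  · exact (support_normalize (w z) (h0 z) (h z)).subset.trans (hws z hz)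
  · refine ContinuousOn.congr (f := fun z => (∑ j ∈ s, w z j)⁻¹ * w z i) ?_
      fun z hz => normalize_apply _ _ _ (hws z hz) i
    refine ContinuousOn.mul (ContinuousOn.inv₀ (continuousOn_finsetSum _ fun j _ => hc j) ?_)
      (hc i)
    intro z hz
    have := sum_pos_of_support_mem (w z) (h0 z) (h z)
    rw [Finsupp.sum_of_support_subset _ (hws z hz) _ (by simp)] at this
    exact this.ne'

/-- The point of `|C|` corresponding to a vertex of `C`. -/
def vertex (C : AbstractSimplicialComplex ι) (v : ι) : Realization C :=
  ofSubset (Finsupp.single v 1)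
    (fun i => by classical rw [Finsupp.single_apply]; split_ifs <;> simp) (by simp)
    ⟨{v}, C.singleton_mem v, Finsupp.support_single_subset⟩

theorem vertex_mem_face {v : ι} {s : Finset ι} (hv : v ∈ s) : vertex C v ∈ face C s :=
  Finsupp.support_single_subset.trans (Finset.singleton_subset_iff.2 hv)

open Classical in
theorem map_mem_face {κ : Type*} {D : AbstractSimplicialComplex κ} {f : ι → κ}
    (hf : IsSimplicialMap C D f) {s : Finset ι} {x : Realization C} (hx : x ∈ face C s) :
    map f hf x ∈ face D (s.image f) := by
  change (Finsupp.mapDomain f x.1).support ⊆ _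
  rw [support_mapDomain f x.1 x.2.1]
  exact Finset.image_subset_image hx

open Classical in
theorem support_map {κ : Type*} {D : AbstractSimplicialComplex κ} {f : ι → κ}
    (hf : IsSimplicialMap C D f) (x : Realization C) :
    (map f hf x).1.support = x.1.support.image f :=
  support_mapDomain f x.1 x.2.1

theorem map_comp {κ μ : Type*} {D : AbstractSimplicialComplex κ} {E : AbstractSimplicialComplex μ}
    {f : ι → κ} {g : κ → μ} (hf : IsSimplicialMap C D f) (hg : IsSimplicialMap D E g)
    (hgf : IsSimplicialMap C E (g ∘ f)) :
    (map g hg).comp (map f hf) = map (g ∘ f) hgf := by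
  ext x : 1
  exact Subtype.ext Finsupp.mapDomain_comp.symm

theorem map_id (h : IsSimplicialMap C C id) : map id h = ContinuousMap.id _ := by
  ext x : 1
  exact Subtype.ext Finsupp.mapDomain_id

open Classical in
theorem homotopic_of_contiguous {κ : Type*} {D : AbstractSimplicialComplex κ} {f g : ι → κ}
    (hf : IsSimplicialMap C D f) (hg : IsSimplicialMap C D g)
    (h : ∀ s ∈ C, s.image f ∪ s.image g ∈ D) : (map f hf).Homotopic (map g hg) :=
  homotopic_of_common_face _ _ fun s hs => ⟨_, h s hs, fun _ hx =>
    ⟨face_mono Finset.subset_union_left (map_mem_face hf hx),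
      face_mono Finset.subset_union_right (map_mem_face hg hx)⟩⟩

/-! ### The map to the barycentric subdivision -/

open Classical in
/-- The length of the interval of levels `u` for which `s` is the set of vertices at which the
barycentric coordinates of `x` exceed `u`. -/
def gap (x : Realization C) (s : SimplexPoset C) : NNReal :=
  s.1.inf' (C.nonempty_of_mem s.2) (fun i => (x.1 i).toNNReal) -
    (x.1.support \ s.1).sup fun i => (x.1 i).toNNReal

open Classical in
-- Vertices outside the support contribute zero to the supremum, so the varying support may be
-- replaced by a fixed face; this makes the gap visibly continuous there.
theorem gap_eq {x : Realization C} {t : Finset ι} (hx : x ∈ face C t) (s : SimplexPoset C) :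
    gap x s = s.1.inf' (C.nonempty_of_mem s.2) (fun i => (x.1 i).toNNReal) -
      (t \ s.1).sup fun i => (x.1 i).toNNReal := by
  refine congrArg _ (le_antisymm (Finset.sup_mono (Finset.sdiff_subset_sdiff hx subset_rfl))
    (Finset.sup_le fun i hi => ?_))
  by_cases h : i ∈ x.1.support
  · exact Finset.le_sup (f := fun i => (x.1 i).toNNReal)
      (Finset.mem_sdiff.2 ⟨h, (Finset.mem_sdiff.1 hi).2⟩)
  · rw [Finsupp.notMem_support_iff.1 h]
    simp

/-- Subtraction in `NNReal` is truncated, so a non-zero gap means that the minimum on `s` strictly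
exceeds the supremum off `s`. -/
theorem lt_of_gap_ne_zero {x : Realization C} {s : SimplexPoset C} (h : gap x s ≠ 0) {i j : ι}
    (hi : i ∈ s.1) (hj : j ∉ s.1) : x.1 j < x.1 i := by
  classical
  -- Inserting `j` makes it count in the supremum even when its coordinate is zero.
  rw [gap_eq (face_mono (Finset.subset_insert j _) x.mem_face_support)] at h
  have h1 := tsub_pos_iff_lt.1 (pos_iff_ne_zero.2 h)
  have h2 : (x.1 j).toNNReal < (x.1 i).toNNReal :=
    ((Finset.le_sup (f := fun i => (x.1 i).toNNReal)
      (Finset.mem_sdiff.2 ⟨Finset.mem_insert_self _ _, hj⟩)).trans_lt h1).trans_le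
      (Finset.inf'_le _ hi)
  exact (Real.toNNReal_lt_toNNReal_iff_of_nonneg (x.nonneg j)).1 h2

theorem subset_support_of_gap_ne_zero {x : Realization C} {s : SimplexPoset C} (h : gap x s ≠ 0) :
    s.1 ⊆ x.1.support := by
  intro i hi
  rw [Finsupp.mem_support_iff]
  rintro h0
  have h1 := tsub_pos_iff_lt.1 (pos_iff_ne_zero.2 h)
  have h2 := (bot_le.trans_lt h1).trans_le (Finset.inf'_le _ hi)
  rw [h0] at h2
  simp at h2

/-- The set of vertices where the coordinate is maximal has a positive gap. -/
theorem exists_gap_ne_zero (x : Realization C) : ∃ s, gap x s ≠ 0 := by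
  classical
  obtain ⟨m, hm, hmax⟩ := x.1.support.exists_max_image (fun i => (x.1 i).toNNReal)
    (C.nonempty_of_mem x.support_mem)
  have hpos : 0 < (x.1 m).toNNReal :=
    Real.toNNReal_pos.2 (lt_of_le_of_ne (x.nonneg m) (Ne.symm (Finsupp.mem_support_iff.1 hm)))
  let s := x.1.support.filter fun i => (x.1 i).toNNReal = (x.1 m).toNNReal
  have hs : s ∈ C := C.mem_of_subset x.support_mem (Finset.filter_subset _ _)
    ⟨m, Finset.mem_filter.2 ⟨hm, rfl⟩⟩
  refine ⟨⟨s, hs⟩, (tsub_pos_iff_lt.2 (lt_of_lt_of_le ?_ (Finset.le_inf' _ _ fun i hi =>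
    (Finset.mem_filter.1 hi).2.ge))).ne'⟩
  refine (Finset.sup_lt_iff hpos).2 fun i hi => ?_
  obtain ⟨hi, his⟩ := Finset.mem_sdiff.1 hi
  exact lt_of_le_of_ne (hmax i hi) fun h => his (Finset.mem_filter.2 ⟨hi, h⟩)

open Classical in
/-- The gaps of `x` as a finitely supported function on the simplices of `C`. -/
def gaps (x : Realization C) : SimplexPoset C →₀ ℝ :=
  Finsupp.onFinset (x.1.support.powerset.subtype (· ∈ C)) (fun s => (gap x s : ℝ))
    fun s hs => Finset.mem_subtype.2 (Finset.mem_powerset.2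
      (subset_support_of_gap_ne_zero fun h => hs (by rw [h]; rfl)))

theorem gap_ne_zero_of_mem {x : Realization C} {s : SimplexPoset C} (h : s ∈ (gaps x).support) :
    gap x s ≠ 0 := fun h0 => Finsupp.mem_support_iff.1 h (NNReal.coe_eq_zero.2 h0)

/-- Simplices with non-zero gap are upper level sets of the coordinates, hence nested. -/
theorem support_gaps_mem (x : Realization C) : (gaps x).support ∈ barycentricSubdivision C := by
  constructor
  · obtain ⟨s, hs⟩ := exists_gap_ne_zero x
    exact ⟨s, Finsupp.mem_support_iff.2 fun h => hs (NNReal.coe_eq_zero.1 h)⟩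
  · intro s hs t ht _
    by_contra! h
    obtain ⟨i, his, hit⟩ := Finset.not_subset.1 h.1
    obtain ⟨j, hjt, hjs⟩ := Finset.not_subset.1 h.2
    exact lt_asymm (lt_of_gap_ne_zero (gap_ne_zero_of_mem hs) his hjs)
      (lt_of_gap_ne_zero (gap_ne_zero_of_mem ht) hjt hit)

/-- A map `|C| → |sd C|` that sends every closed face `|t|` to the subdivision of `t`. -/
def toSubdivision (C : AbstractSimplicialComplex ι) :
    C(Realization C, Realization (barycentricSubdivision C)) where
  toFun x := normalize (gaps x) (fun s => (gap x s).2) (support_gaps_mem x)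
  continuous_toFun := by
    classical
    refine continuous_of_face fun t _ => continuousOn_normalize
      (s := t.powerset.subtype (· ∈ C)) _ _ _ (fun x hx s hs => ?_) fun s => ?_
    · exact Finset.mem_subtype.2 (Finset.mem_powerset.2
        ((subset_support_of_gap_ne_zero (gap_ne_zero_of_mem hs)).trans hx))
    · have hc : ∀ i, Continuous fun x : Realization C => (x.1 i).toNNReal := fun i =>
        continuous_real_toNNReal.comp (continuous_coord i)
      refine ContinuousOn.congr (Continuous.continuousOn ?_)
        fun x hx => congrArg NNReal.toReal (gap_eq hx s)
      exact NNReal.continuous_coe.comp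
        ((Continuous.finset_inf'_apply _ fun i _ => hc i).sub
          (Continuous.finset_sup_apply fun i _ => hc i))

theorem subset_of_mem_support_toSubdivision {x : Realization C} {t : Finset ι}
    (hx : x ∈ face C t) {s : SimplexPoset C} (hs : s ∈ (toSubdivision C x).1.support) :
    s.1 ⊆ t := by
  have h := (support_normalize (gaps x) (fun s => (gap x s).2) (support_gaps_mem x)).subset hs
  exact (subset_support_of_gap_ne_zero (gap_ne_zero_of_mem h)).trans hx

open Classical in
/-- A simplicial map `sd C → C` that picks a vertex of every simplex is, after composition with
`|C| → |sd C|`, homotopic to the identity. -/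
theorem map_comp_toSubdivision_homotopic (v : SimplexPoset C → ι) (hv : ∀ s, v s ∈ s.1)
    (h : IsSimplicialMap (barycentricSubdivision C) C v) :
    ((map v h).comp (toSubdivision C)).Homotopic (ContinuousMap.id _) := by
  refine homotopic_of_common_face _ _ fun t ht => ⟨t, ht, fun x hx => ⟨?_, hx⟩⟩
  intro i hi
  obtain ⟨s, hs, rfl⟩ := Finset.mem_image.1 ((support_map h _).subset hi)
  exact subset_of_mem_support_toSubdivision hx hs (hv s)

/-- All vertices chosen along a chain lie in its largest simplex. -/
theorem isSimplicialMap_vertex_choice (v : SimplexPoset C → ι) (hv : ∀ s, v s ∈ s.1) :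
    IsSimplicialMap (barycentricSubdivision C) C v := by
  classical
  intro c hc
  obtain ⟨m, hm⟩ := exists_isGreatest_of_mem_orderComplex c hc
  refine C.mem_of_subset m.2 ?_ (hc.1.image _)
  intro i hi
  obtain ⟨s, hs, rfl⟩ := Finset.mem_image.1 hi
  exact hm.2 hs (hv s)

end Realization

/-! ### Comparable maps of posets -/

section Order

open Realization

variable {S T : Type*} [PartialOrder S] [PartialOrder T]

theorem chainMin_mem (c : SimplexPoset (orderComplex S)) : chainMin c ∈ c.1 :=
  (isLeast_chainMin c).1

theorem chainMax_mem (c : SimplexPoset (orderComplex S)) : chainMax c ∈ c.1 :=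
  (isGreatest_chainMax c).1

theorem le_chainMax (c : SimplexPoset (orderComplex S)) {a : S} (ha : a ∈ c.1) : a ≤ chainMax c :=
  (isGreatest_chainMax c).2 ha

theorem chainMin_le (c : SimplexPoset (orderComplex S)) {a : S} (ha : a ∈ c.1) : chainMin c ≤ a :=
  (isLeast_chainMin c).2 ha

/-- Comparable order-preserving maps have homotopic realisations. -/
theorem posetRealizationMap_homotopic_of_le {f g : S →o T} (hfg : f ≤ g) :
    (posetRealizationMap f).Homotopic (posetRealizationMap g) := by
  classical
  -- For a chain $c$ in $S$ the union $f(c)\cup g(c)$ need not be a chain, so the comparison is made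
  -- on the subdivision: in a nested family of chains the minima decrease, the maxima increase, and
  -- every minimum is below every maximum.
  have key : ∀ {f g : S →o T} (_ : f ≤ g) (c), c ∈ barycentricSubdivision (orderComplex S) →
      c.image (f ∘ chainMin) ∪ c.image (g ∘ chainMax) ∈ orderComplex T := by
    intro f g hfg c hc
    refine ⟨(hc.1.image _).mono Finset.subset_union_left, ?_⟩
    have hmm : ∀ a ∈ c, ∀ b ∈ c, f (chainMin a) ≤ g (chainMax b) := by
      intro a ha b hb
      refine (hfg _).trans (g.monotone ?_)
      rcases hc.2.total ha hb with h | h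
      · exact (chainMin_le a (chainMin_mem a)).trans (le_chainMax b (h (chainMin_mem a)))
      · exact (chainMin_le a (h (chainMin_mem b))).trans (le_chainMax b (chainMin_mem b))
    intro x hx y hy _
    simp only [Finset.coe_union, Finset.coe_image, mem_union, mem_image, Finset.mem_coe,
      Function.comp] at hx hy
    obtain ⟨a, ha, rfl⟩ | ⟨a, ha, rfl⟩ := hx <;> obtain ⟨b, hb, rfl⟩ | ⟨b, hb, rfl⟩ := hy
    · exact (hc.2.total ha hb).symm.imp
        (fun h => f.monotone (chainMin_le a (h (chainMin_mem b))))
        (fun h => f.monotone (chainMin_le b (h (chainMin_mem a))))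
    · exact Or.inl (hmm a ha b hb)
    · exact Or.inr (hmm b hb a ha)
    · exact (hc.2.total ha hb).imp
        (fun h => g.monotone (le_chainMax b (h (chainMax_mem a))))
        (fun h => g.monotone (le_chainMax a (h (chainMax_mem b))))
  have hmin : IsSimplicialMap (barycentricSubdivision (orderComplex S)) (orderComplex T)
      (f ∘ chainMin) := fun c hc => (orderComplex T).mem_of_subset
    (by convert key hfg c hc) (by convert Finset.subset_union_left) (by convert hc.1.image _)
  have hmax : ∀ g : S →o T, IsSimplicialMap (barycentricSubdivision (orderComplex S))
      (orderComplex T) (g ∘ chainMax) := fun g c hc => (orderComplex T).mem_of_subset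
    (by convert key le_rfl c hc) (by convert Finset.subset_union_right) (by convert hc.1.image _)
  -- On the subdivision, $f\circ\max\simeq f\circ\min\simeq g\circ\max$.
  have h1 : (map _ (hmax f)).Homotopic (map _ (hmax g)) :=
    (homotopic_of_contiguous hmin (hmax f) fun c hc => by convert key le_rfl c hc).symm.trans
      (homotopic_of_contiguous hmin (hmax g) fun c hc => by convert key hfg c hc)
  have hM := isSimplicialMap_vertex_choice (C := orderComplex S) chainMax chainMax_mem
  have h2 : ∀ g : S →o T, ((map _ (hmax g)).comp (toSubdivision _)).Homotopic
      (posetRealizationMap g) := fun g => by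
    have h := (ContinuousMap.Homotopic.refl (posetRealizationMap g)).comp
      (map_comp_toSubdivision_homotopic chainMax chainMax_mem hM)
    rw [ContinuousMap.comp_id, ← ContinuousMap.comp_assoc, posetRealizationMap,
      map_comp hM (isSimplicialMap_of_monotone g g.monotone) (hmax g)] at h
    exact h
  have h3 := ContinuousMap.Homotopic.comp h1
    (ContinuousMap.Homotopic.refl (toSubdivision (orderComplex S)))
  exact ((h2 f).symm.trans h3).trans (h2 g)

end Order

/-! ### Contractible carriers -/

/-- A contraction of a subset `A` of a space `Y` to a point, within `A`. -/
structure SetContraction {Y : Type*} [TopologicalSpace Y] (A : Set Y) where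
  center : Y
  toFun : Y → I → Y
  center_mem : center ∈ A
  mapsTo : ∀ y ∈ A, ∀ t, toFun y t ∈ A
  map_zero : ∀ y ∈ A, toFun y 0 = y
  map_one : ∀ y ∈ A, toFun y 1 = center
  continuousOn : ContinuousOn (fun z : Y × I => toFun z.1 z.2) (A ×ˢ univ)

open Classical in
theorem SetContraction.nonempty_of_contractibleSpace {Y : Type*} [TopologicalSpace Y] (A : Set Y)
    [ContractibleSpace A] : Nonempty (SetContraction A) := by
  obtain ⟨c, ⟨h⟩⟩ := id_nullhomotopic A
  refine ⟨⟨c, fun y t => if hy : y ∈ A then h (t, ⟨y, hy⟩) else y, c.2, fun y hy t => ?_,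
    fun y hy => ?_, fun y hy => ?_, ?_⟩⟩
  · simp [hy]
  · simp [hy]
  · simp [hy]
  · rw [continuousOn_iff_continuous_domRestrict]
    have : Continuous fun z : (A ×ˢ univ : Set (Y × I)) => (h (z.1.2, ⟨z.1.1, z.2.1⟩)).1 := by
      fun_prop
    convert! this using 2 with z
    exact dif_pos z.2.1

namespace Realization

variable {P : Type*} [PartialOrder P]

/-- The largest vertex of the carrier of a point of an order complex. -/
def top (x : Realization (orderComplex P)) : P :=
  chainMax ⟨x.1.support, x.support_mem⟩

theorem top_mem (x : Realization (orderComplex P)) : x.top ∈ x.1.support :=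
  chainMax_mem ⟨x.1.support, x.support_mem⟩

theorem le_top {x : Realization (orderComplex P)} {p : P} (hp : p ∈ x.1.support) : p ≤ x.top :=
  le_chainMax ⟨x.1.support, x.support_mem⟩ hp

theorem top_eq {x : Realization (orderComplex P)} {p : P} (hp : p ∈ x.1.support)
    (h : ∀ q ∈ x.1.support, q ≤ p) : x.top = p :=
  le_antisymm (h _ x.top_mem) (le_top hp)

/-- A barycentric coordinate as a point of the unit interval. -/
def coordI {ι : Type*} {C : AbstractSimplicialComplex ι} (i : ι) (x : Realization C) : I :=
  ⟨x.1 i, x.nonneg i, x.le_one i⟩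

theorem continuous_coordI {ι : Type*} {C : AbstractSimplicialComplex ι} (i : ι) :
    Continuous (coordI (C := C) i) :=
  (continuous_coord i).subtype_mk _

section drop

variable {ι : Type*} {C : AbstractSimplicialComplex ι}

theorem support_erase_mem (x : Realization C) (p : ι) (h : x.1 p ≠ 1) :
    (x.1.erase p).support ∈ C := by
  classical
  rw [Finsupp.support_erase]
  refine C.mem_of_subset x.support_mem (Finset.erase_subset _ _) ?_
  rw [Finset.nonempty_iff_ne_empty]
  intro h0
  refine h ?_
  have hx : x ∈ face C {p} := by
    intro i hi
    by_contra hip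
    have : i ∈ x.1.support.erase p := Finset.mem_erase.2 ⟨fun h => hip (by simp [h]), hi⟩
    rw [h0] at this
    simp at this
  simpa using sum_eq_one hx

theorem erase_nonneg (x : Realization C) (p i : ι) : 0 ≤ x.1.erase p i := by
  classical
  rw [Finsupp.erase_apply]
  split_ifs
  exacts [le_rfl, x.nonneg i]

/-- The projection of a point away from a vertex onto the opposite face. -/
def drop (x : Realization C) (p : ι) (h : x.1 p ≠ 1) : Realization C :=
  normalize (x.1.erase p) (x.erase_nonneg p) (x.support_erase_mem p h)

open Classical in
theorem support_drop (x : Realization C) (p : ι) (h : x.1 p ≠ 1) :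
    (x.drop p h).1.support = x.1.support.erase p :=
  (support_normalize _ (x.erase_nonneg p) (x.support_erase_mem p h)).trans
    Finsupp.support_erase

theorem drop_eq_self (x : Realization C) (p : ι) (h : x.1 p ≠ 1) (h0 : x.1 p = 0) :
    x.drop p h = x := by
  refine Subtype.ext ?_
  change ((x.1.erase p).sum fun _ a => a)⁻¹ • x.1.erase p = x.1
  rw [Finsupp.erase_of_notMem_support (Finsupp.notMem_support_iff.2 h0)]
  have : (x.1.sum fun _ a => a) = 1 := x.2.2.2
  rw [this, inv_one, one_smul]

open Classical in
theorem continuous_drop (p : ι) (s : Finset ι) :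
    Continuous fun x : {x // x ∈ face C s ∧ x.1 p ≠ 1} => drop x.1 p x.2.2 := by
  rw [← continuousOn_univ]
  refine continuousOn_normalize (s := s) _ _ _ (fun x _ => ?_) fun i => ?_
  · exact (Finsupp.support_erase.subset.trans (Finset.erase_subset _ _)).trans x.2.1
  · simp only [Finsupp.erase_apply]
    split_ifs
    · exact continuousOn_const
    · exact ((continuous_coord i).comp continuous_subtype_val).continuousOn

end drop

variable {Y : Type*} [TopologicalSpace Y] {F : P → Set Y}

open Classical in
/-- The map on an order complex that extends `φ₀` from the part over `D` by coning off, chain by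
chain, with given contractions. -/
def carrierMap (K : ∀ p, SetContraction (F p)) (D : Set P)
    (φ₀ : Realization (orderComplex P) → Y) (x : Realization (orderComplex P)) : Y :=
  if x.top ∈ D then φ₀ x
  else if h : x.1 x.top = 1 then (K x.top).center
  -- A point is a convex combination of its top vertex and its projection to the opposite face; the
  -- weight of the top vertex serves as the time of the contraction.
  else (K x.top).toFun (carrierMap K D φ₀ (x.drop x.top h)) (coordI x.top x)
termination_by x.1.support.card
decreasing_by
  rw [support_drop]
  exact Finset.card_erase_lt_of_mem x.top_mem

variable {K : ∀ p, SetContraction (F p)} {D : Set P} {φ₀ : Realization (orderComplex P) → Y}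

theorem carrierMap_of_mem {x : Realization (orderComplex P)} (h : x.top ∈ D) :
    carrierMap K D φ₀ x = φ₀ x := by
  rw [carrierMap, if_pos h]

theorem top_drop_le (x : Realization (orderComplex P)) (p : P) (h) : (x.drop p h).top ≤ x.top := by
  classical
  have := (x.drop p h).top_mem
  rw [support_drop] at this
  exact le_top (Finset.mem_of_mem_erase this)

theorem carrierMap_mem (hF : Monotone F) (h₀ : ∀ x, x.top ∈ D → φ₀ x ∈ F x.top)
    (x : Realization (orderComplex P)) : carrierMap K D φ₀ x ∈ F x.top := by
  classical
  induction hn : x.1.support.card using Nat.strong_induction_on generalizing x with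
  | _ n ih =>
    rw [carrierMap]
    split_ifs with h h1
    · exact h₀ x h
    · exact (K _).center_mem
    · refine (K _).mapsTo _ (hF (x.top_drop_le _ h1) (ih _ ?_ _ rfl)) _
      rw [← hn, support_drop]
      exact Finset.card_erase_lt_of_mem x.top_mem

/-- One formula serves the whole face away from the vertex `p`: where the coordinate of `p` vanishes
the top is smaller, but the contraction at time zero is the identity. -/
theorem carrierMap_eq_of_isGreatest (hF : Monotone F)
    (h₀ : ∀ x, x.top ∈ D → φ₀ x ∈ F x.top) {s : Finset P} {p : P} (hp : IsGreatest (s : Set P) p)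
    (hpD : p ∉ D) {x : Realization (orderComplex P)} (hx : x ∈ face _ s) (h : x.1 p ≠ 1) :
    carrierMap K D φ₀ x = (K p).toFun (carrierMap K D φ₀ (x.drop p h)) (coordI p x) := by
  by_cases h0 : x.1 p = 0
  · have : coordI p x = 0 := Subtype.ext h0
    rw [x.drop_eq_self p h h0, this]
    exact ((K p).map_zero _ (hF (hp.2 (hx x.top_mem)) (carrierMap_mem hF h₀ x))).symm
  · have htop : x.top = p := top_eq (Finsupp.mem_support_iff.2 h0) fun q hq => hp.2 (hx hq)
    subst htop
    conv_lhs => rw [carrierMap]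
    rw [if_neg hpD, dif_neg h]

theorem eq_of_mem_face_singleton {ι : Type*} {C : AbstractSimplicialComplex ι} {p : ι}
    {x y : Realization C} (hx : x ∈ face C {p}) (hy : y ∈ face C {p}) : x = y := by
  ext i
  by_cases hi : i = p
  · subst hi
    have h1 := sum_eq_one hx
    have h2 := sum_eq_one hy
    rw [Finset.sum_singleton] at h1 h2
    exact h1.trans h2.symm
  · have hi' : i ∉ ({p} : Finset ι) := by simpa using hi
    rw [eq_zero_of_mem_face hx hi', eq_zero_of_mem_face hy hi']

/-- Induction on `s`. Away from the top vertex the coning formula is a composite of continuous maps.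
At that vertex the projection is undefined, but the contraction tends to its centre uniformly over
the compact opposite face. -/
theorem continuousOn_carrierMap (hF : Monotone F) (hD : IsLowerSet D)
    (h₀ : ∀ x, x.top ∈ D → φ₀ x ∈ F x.top)
    (hc : ∀ s ∈ orderComplex P, (s : Set P) ⊆ D → ContinuousOn φ₀ (face _ s)) (s : Finset P)
    (hs : s ∈ orderComplex P) : ContinuousOn (carrierMap K D φ₀) (face _ s) := by
  classical
  induction s using Finset.strongInduction with
  | _ s ih =>
  obtain ⟨p, hp⟩ := exists_isGreatest_of_mem_orderComplex s hs
  by_cases hpD : p ∈ D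
  · have hsD : (s : Set P) ⊆ D := fun q hq => hD (hp.2 hq) hpD
    exact (hc s hs hsD).congr fun x hx => carrierMap_of_mem (hsD (hx x.top_mem))
  by_cases hne : (s.erase p).Nonempty
  swap
  · have hsp : s ⊆ {p} := by
      rw [Finset.not_nonempty_iff_eq_empty, Finset.erase_eq_empty_iff] at hne
      rcases hne with rfl | rfl <;> simp
    exact Subsingleton.continuousOn (fun x hx y hy =>
      eq_of_mem_face_singleton (face_mono hsp hx) (face_mono hsp hy)) _
  have hs' : s.erase p ∈ orderComplex P :=
    AbstractSimplicialComplex.mem_of_subset _ hs (Finset.erase_subset _ _) hne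
  have ih' := ih _ (Finset.erase_ssubset hp.1) hs'
  have hmem : ∀ y ∈ face (orderComplex P) (s.erase p), carrierMap K D φ₀ y ∈ F p :=
    fun y hy => hF (hp.2 (Finset.erase_subset _ _ (hy y.top_mem))) (carrierMap_mem hF h₀ y)
  have hdrop : ∀ (x) (h : x.1 p ≠ 1), x ∈ face (orderComplex P) s →
      x.drop p h ∈ face (orderComplex P) (s.erase p) := fun x h hx =>
    (support_drop x p h).subset.trans (Finset.erase_subset_erase _ hx)
  have heq : ∀ x ∈ face (orderComplex P) s, ∀ h : x.1 p ≠ 1, carrierMap K D φ₀ x =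
      (K p).toFun (carrierMap K D φ₀ (x.drop p h)) (coordI p x) :=
    fun x hx h => carrierMap_eq_of_isGreatest hF h₀ hp hpD hx h
  intro x hx
  by_cases h1 : x.1 p = 1
  · have hval : ∀ y ∈ face (orderComplex P) s, y.1 p = 1 →
        carrierMap K D φ₀ y = (K p).center := by
      intro y hy hy1
      have htop : y.top = p := top_eq (Finsupp.mem_support_iff.2 (by rw [hy1]; exact one_ne_zero))
        fun q hq => hp.2 (hy hq)
      rw [carrierMap, htop, if_neg hpD, dif_pos hy1]
    change Filter.Tendsto _ _ _
    rw [hval x hx h1]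
    intro U hU
    have := isCompact_iff_compactSpace.1 (isCompact_face hs')
    have hg : Continuous fun z : I × face (orderComplex P) (s.erase p) =>
        (K p).toFun (carrierMap K D φ₀ z.2.1) z.1 :=
      (K p).continuousOn.comp_continuous
        (f := fun z : I × face (orderComplex P) (s.erase p) => (carrierMap K D φ₀ z.2.1, z.1))
        ((ih'.domRestrict.comp continuous_snd).prodMk continuous_fst)
        fun z => ⟨hmem _ z.2.2, mem_univ _⟩
    -- Tube lemma: near time one the whole image of the opposite face lies in `U`.
    have hev : ∀ᶠ t : I in 𝓝 1, ∀ y ∈ (univ : Set (face (orderComplex P) (s.erase p))),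
        (K p).toFun (carrierMap K D φ₀ y.1) t ∈ U := by
      refine isCompact_univ.eventually_forall_of_forall_eventually fun y _ => ?_
      refine hg.continuousAt.eventually_mem ?_
      rwa [(K p).map_one _ (hmem _ y.2)]
    have ht : Filter.Tendsto (coordI (C := orderComplex P) p) (𝓝[face _ s] x) (𝓝 1) := by
      have : coordI p x = 1 := Subtype.ext h1
      rw [← this]
      exact (continuous_coordI p).continuousWithinAt
    rw [Filter.mem_map]
    filter_upwards [ht.eventually hev, self_mem_nhdsWithin] with y hy hys
    by_cases hy1 : y.1 p = 1
    · rw [mem_preimage, hval y hys hy1]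
      exact mem_of_mem_nhds hU
    · rw [mem_preimage, heq y hys hy1]
      exact hy ⟨_, hdrop y hy1 hys⟩ (mem_univ _)
  · have hA : ContinuousOn (carrierMap K D φ₀) {x | x ∈ face _ s ∧ x.1 p ≠ 1} := by
      rw [continuousOn_iff_continuous_domRestrict]
      have h2 : Continuous fun z : {x // x ∈ face (orderComplex P) s ∧ x.1 p ≠ 1} =>
          (K p).toFun (carrierMap K D φ₀ (z.1.drop p z.2.2)) (coordI p z.1) :=
        (K p).continuousOn.comp_continuous
          (f := fun z : {x // x ∈ face (orderComplex P) s ∧ x.1 p ≠ 1} =>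
            (carrierMap K D φ₀ (z.1.drop p z.2.2), coordI p z.1))
          ((ih'.comp_continuous (continuous_drop p s) fun z => hdrop _ z.2.2 z.2.1).prodMk
            ((continuous_coordI p).comp continuous_subtype_val))
          fun z => ⟨hmem _ (hdrop _ z.2.2 z.2.1), mem_univ _⟩
      exact h2.congr fun z => (heq z.1 z.2.1 z.2.2).symm
    have hopen : IsOpen {x : Realization (orderComplex P) | x.1 p ≠ 1} :=
      isOpen_ne_fun (continuous_coord p) continuous_const
    exact (hA x ⟨hx, h1⟩).mono_of_mem_nhdsWithin
      (Filter.inter_mem self_mem_nhdsWithin (mem_nhdsWithin_of_mem_nhds (hopen.mem_nhds h1)))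

/-- Contractible carriers on an order complex: a map defined over a lower set extends. -/
theorem exists_extension_of_contractible (hF : Monotone F) [∀ p, ContractibleSpace (F p)]
    (hD : IsLowerSet D) (h₀ : ∀ x, x.top ∈ D → φ₀ x ∈ F x.top)
    (hc : ∀ s ∈ orderComplex P, (s : Set P) ⊆ D → ContinuousOn φ₀ (face _ s)) :
    ∃ φ : C(Realization (orderComplex P), Y), (∀ x, φ x ∈ F x.top) ∧
      ∀ x, x.top ∈ D → φ x = φ₀ x := by
  have K : ∀ p, SetContraction (F p) := fun p =>
    (SetContraction.nonempty_of_contractibleSpace (F p)).some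
  exact ⟨⟨carrierMap K D φ₀, continuous_of_face (continuousOn_carrierMap hF hD h₀ hc)⟩,
    carrierMap_mem hF h₀, fun x => carrierMap_of_mem⟩

theorem exists_carried_map (hF : Monotone F) [∀ p, ContractibleSpace (F p)] :
    ∃ φ : C(Realization (orderComplex P), Y), ∀ x, φ x ∈ F x.top := by
  classical
  have hne : ∀ p, Nonempty (F p) := fun p => inferInstance
  -- With `D` empty nothing is prescribed, and `φ₀` is a dummy.
  obtain ⟨φ, h, -⟩ := exists_extension_of_contractible hF (D := ∅)
    (φ₀ := fun x => (hne x.top).some.1) isLowerSet_empty (fun x => by simp)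
    (fun s hs hsD => by
      obtain ⟨a, ha⟩ := hs.1
      exact (hsD ha).elim)
  exact ⟨φ, h⟩

theorem top_posetRealizationMap {Q : Type*} [PartialOrder Q] (f : P →o Q)
    (x : Realization (orderComplex P)) : (posetRealizationMap f x).top = f x.top := by
  classical
  have hsupp : (posetRealizationMap f x).1.support = x.1.support.image f :=
    support_map (isSimplicialMap_of_monotone f f.monotone) x
  refine top_eq ?_ ?_
  · rw [hsupp]
    exact Finset.mem_image_of_mem _ x.top_mem
  · rw [hsupp]
    intro q hq
    obtain ⟨a, ha, rfl⟩ := Finset.mem_image.1 hq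
    exact f.monotone (le_top ha)

/-- Two maps with the same contractible carriers are homotopic. -/
theorem homotopic_of_contractible_carrier (hF : Monotone F) [∀ p, ContractibleSpace (F p)]
    (φ ψ : C(Realization (orderComplex P), Y)) (hφ : ∀ x, φ x ∈ F x.top)
    (hψ : ∀ x, ψ x ∈ F x.top) : φ.Homotopic ψ := by
  classical
  -- `L` has two incomparable elements below a top, so it models an interval. Prescribing `φ` and
  -- `ψ` over its two minimal elements and extending over the top gives `Φ`; the inclusions of `P`
  -- at both ends are homotopic to the one at the top.
  let L := WithTop (Unit ⊕ Unit)
  let pr : P × L →o P := ⟨Prod.fst, fun _ _ h => h.1⟩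
  let i : L → P →o P × L := fun l => ⟨fun p => (p, l), fun _ _ h => ⟨h, le_rfl⟩⟩
  let l₀ : L := ((Sum.inl () : Unit ⊕ Unit) : L)
  let l₁ : L := ((Sum.inr () : Unit ⊕ Unit) : L)
  let D : Set (P × L) := {q | q.2 ≠ ⊤}
  let φ₀ : Realization (orderComplex (P × L)) → Y := fun x =>
    if x.top.2 = l₀ then φ (posetRealizationMap pr x) else ψ (posetRealizationMap pr x)
  have hD : IsLowerSet D := fun a b hba ha hb => ha (top_le_iff.1 (hb ▸ hba.2))
  -- A chain inside `D` stays over a single end of `L`, so `φ₀` is given there by just one of the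
  -- two maps.
  have hlow : ∀ a b : P × L, b ≤ a → a ∈ D → b.2 = a.2 := by
    rintro ⟨a, l⟩ ⟨b, m⟩ ⟨-, hba⟩ ha
    dsimp only at hba ⊢
    induction l using WithTop.recTopCoe with
    | top => exact (ha rfl).elim
    | coe l =>
      induction m using WithTop.recTopCoe with
      | top => exact (WithTop.coe_ne_top (top_le_iff.1 hba)).elim
      | coe m =>
        have := WithTop.coe_le_coe.1 hba
        rcases l with ⟨⟩ | ⟨⟩ <;> rcases m with ⟨⟩ | ⟨⟩ <;> simp at this ⊢
  obtain ⟨Φ, -, hΦ⟩ := exists_extension_of_contractible (F := fun q : P × L => F q.1)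
    (fun _ _ h => hF h.1) hD (φ₀ := φ₀) (fun x _ => by
      have h := top_posetRealizationMap pr x
      simp only [φ₀]
      split_ifs
      · exact (congrArg F h).subset (hφ _)
      · exact (congrArg F h).subset (hψ _))
    (fun s hs hsD => by
      obtain ⟨p, hp⟩ := exists_isGreatest_of_mem_orderComplex s hs
      have htop : ∀ x ∈ face (orderComplex (P × L)) s, x.top.2 = p.2 := fun x hx =>
        hlow _ _ (hp.2 (hx x.top_mem)) (hsD hp.1)
      by_cases h0 : p.2 = l₀
      · exact (φ.continuous.comp (posetRealizationMap pr).continuous).continuousOn.congr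
          fun x hx => if_pos ((htop x hx).trans h0)
      · exact (ψ.continuous.comp (posetRealizationMap pr).continuous).continuousOn.congr
          fun x hx => if_neg fun h => h0 ((htop x hx).symm.trans h))
  have hid : ∀ l x, posetRealizationMap pr (posetRealizationMap (i l) x) = x := fun l x => by
    have hl := isSimplicialMap_of_monotone (i l) (i l).monotone
    have hp := isSimplicialMap_of_monotone pr pr.monotone
    have h := map_comp hl hp (isSimplicialMap_of_monotone id monotone_id)
    exact (DFunLike.congr_fun h x).trans (DFunLike.congr_fun (map_id _) x)
  have e₀ : Φ.comp (posetRealizationMap (i l₀)) = φ := by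
    ext x
    have ht := top_posetRealizationMap (i l₀) x
    refine (hΦ _ (by rw [ht]; exact WithTop.coe_ne_top)).trans ?_
    simp only [φ₀]
    rw [if_pos (by rw [ht]; rfl), hid]
  have e₁ : Φ.comp (posetRealizationMap (i l₁)) = ψ := by
    ext x
    have ht := top_posetRealizationMap (i l₁) x
    refine (hΦ _ (by rw [ht]; exact WithTop.coe_ne_top)).trans ?_
    simp only [φ₀]
    rw [if_neg, hid]
    rw [ht]
    intro h
    cases WithTop.coe_injective h
  have h : ∀ l, (posetRealizationMap (i l)).Homotopic (posetRealizationMap (i ⊤)) := fun l =>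
    posetRealizationMap_homotopic_of_le fun p => ⟨le_rfl, _root_.le_top⟩
  rw [← e₀, ← e₁]
  exact ContinuousMap.Homotopic.comp (.refl Φ) ((h l₀).trans (h l₁).symm)

end Realization

/-! ### Full subcomplexes as closed subspaces -/

/-- The full subcomplex of `C` on a set `A` of vertices. -/
def AbstractSimplicialComplex.induce {ι : Type*} (C : AbstractSimplicialComplex ι) (A : Set ι) :
    AbstractSimplicialComplex A where
  faces := {s | s.map (Function.Embedding.subtype _) ∈ C}
  isRelLowerSet_faces := fun _ hs =>
    ⟨Finset.map_nonempty.1 (C.nonempty_of_mem hs), fun _ hts ht =>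
      C.mem_of_subset hs (Finset.map_subset_map.2 hts) (Finset.map_nonempty.2 ht)⟩
  singleton_mem v := by
    change Finset.map _ _ ∈ C
    rw [Finset.map_singleton]
    exact C.singleton_mem v.1

theorem AbstractSimplicialComplex.mem_induce {ι : Type*} {C : AbstractSimplicialComplex ι}
    {A : Set ι} {s : Finset A} :
    s ∈ C.induce A ↔ s.map (Function.Embedding.subtype _) ∈ C := Iff.rfl

theorem isChain_map_subtype {S : Type*} [PartialOrder S] {A : Set S} {s : Finset A} :
    IsChain (· ≤ ·) (s.map (Function.Embedding.subtype _) : Set S) ↔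
      IsChain (· ≤ ·) (s : Set A) := by
  rw [Finset.coe_map]
  change IsChain _ (Subtype.val '' (s : Set A)) ↔ _
  constructor
  · intro h a ha b hb hab
    exact h (mem_image_of_mem _ ha) (mem_image_of_mem _ hb) fun h => hab (Subtype.ext h)
  · rintro h _ ⟨a, ha, rfl⟩ _ ⟨b, hb, rfl⟩ hab
    exact h ha hb fun h => hab (congrArg _ h)

theorem orderComplex_induce {S : Type*} [PartialOrder S] (A : Set S) :
    (orderComplex S).induce A = orderComplex A :=
  SetLike.ext fun _ => and_congr Finset.map_nonempty isChain_map_subtype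

namespace Realization

variable {ι : Type*} {C : AbstractSimplicialComplex ι}

/-- The part of `|C|` over a set of vertices. -/
def full (C : AbstractSimplicialComplex ι) (A : Set ι) : Set (Realization C) :=
  {x | ∀ i ∈ x.1.support, i ∈ A}

theorem full_mono {A B : Set ι} (h : A ⊆ B) : full C A ⊆ full C B :=
  fun _ hx i hi => h (hx i hi)

theorem isClosed_full (A : Set ι) : IsClosed (full C A) := by
  have : full C A = ⋂ i, ⋂ (_ : i ∉ A), {x : Realization C | x.1 i = 0} := by
    ext x
    simp only [mem_iInter]
    refine ⟨fun hx i hi => ?_, fun hx i hi => ?_⟩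
    · by_contra h
      exact hi (hx i (Finsupp.mem_support_iff.2 h))
    · by_contra his
      exact Finsupp.mem_support_iff.1 hi (hx i his)
  rw [this]
  exact isClosed_iInter fun i => isClosed_iInter fun _ =>
    isClosed_eq (continuous_coord i) continuous_const

theorem isClosed_face (s : Finset ι) : IsClosed (face C s) :=
  isClosed_full (s : Set ι)

theorem isClosed_of_inter_face {B : Set (Realization C)}
    (h : ∀ s ∈ C, IsClosed (B ∩ face C s)) : IsClosed B := by
  rw [← isOpen_compl_iff]
  refine continuous_Prop.1 (continuous_of_face (f := fun x => x ∈ Bᶜ) fun s hs => ?_)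
  rw [continuousOn_iff_continuous_domRestrict]
  refine continuous_Prop.2 ?_
  convert! ((h s hs).preimage (continuous_subtype_val (p := (· ∈ face C s)))).isOpen_compl using 1
  ext x
  exact not_congr (and_iff_left x.2).symm

/-- A closed subspace inherits the coherent topology; this gives continuity of the inverse in
`induceHomeomorph`. -/
theorem continuous_of_face_of_isClosed {Z : Set (Realization C)} (hZ : IsClosed Z) {W : Type*}
    [TopologicalSpace W] {f : Z → W}
    (h : ∀ s ∈ C, ContinuousOn f (Subtype.val ⁻¹' face C s)) : Continuous f := by
  refine continuous_iff_isClosed.2 fun B hB => ?_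
  have hcl : IsClosed (Subtype.val '' (f ⁻¹' B)) := by
    refine isClosed_of_inter_face fun s hs => ?_
    obtain ⟨u, hu, hfu⟩ := continuousOn_iff_isClosed.1 (h s hs) B hB
    rw [← image_inter_preimage, hfu]
    exact hZ.isClosedEmbedding_subtypeVal.isClosedMap _
      (hu.inter ((isClosed_face s).preimage continuous_subtype_val))
  rw [← preimage_image_eq (f ⁻¹' B) Subtype.val_injective]
  exact hcl.preimage continuous_subtype_val

theorem isSimplicialMap_val (A : Set ι) : IsSimplicialMap (C.induce A) C Subtype.val := by
  classical
  intro s hs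
  have := AbstractSimplicialComplex.mem_induce.1 hs
  rw [Finset.map_eq_image] at this
  convert! this

/-- The realisation of a full subcomplex is a subspace. -/
def induceHomeomorph (C : AbstractSimplicialComplex ι) (A : Set ι) :
    Realization (C.induce A) ≃ₜ full C A where
  toFun x := ⟨map Subtype.val (isSimplicialMap_val A) x, fun i hi => by
    classical
    obtain ⟨a, -, rfl⟩ := Finset.mem_image.1 ((support_map (isSimplicialMap_val A) x).subset hi)
    exact a.2⟩
  invFun x := ⟨x.1.1.subtypeDomain (· ∈ A), fun i => x.1.nonneg _, by
    classical
    rw [AbstractSimplicialComplex.mem_induce, Finsupp.support_subtypeDomain,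
      Finset.subtype_map_of_mem x.2]
    exact x.1.support_mem,
    (Finsupp.sum_subtypeDomain_index (h := fun _ a => a) x.2).trans x.1.2.2.2⟩
  left_inv x := by
    ext i
    exact Finsupp.mapDomain_apply Subtype.val_injective _ _
  right_inv x := by
    refine Subtype.ext (Realization.ext fun i => ?_)
    by_cases hi : i ∈ A
    · exact Finsupp.mapDomain_apply Subtype.val_injective _ (⟨i, hi⟩ : A)
    · refine (Finsupp.mapDomain_of_notMem_range _ _ (by simpa using hi)).trans ?_
      by_contra h
      exact hi (x.2 i (Finsupp.mem_support_iff.2 (Ne.symm h)))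
  continuous_toFun := (map Subtype.val (isSimplicialMap_val A)).continuous.subtype_mk _
  continuous_invFun := by
    classical
    refine continuous_of_face_of_isClosed (isClosed_full A) fun s hs =>
      continuousOn_of_coord (T := s.subtype (· ∈ A)) (fun x hx i hi => ?_) fun i => ?_
    · exact Finset.mem_subtype.2 (hx (Finset.mem_subtype.1
        (Finsupp.support_subtypeDomain.subset hi)))
    · exact ((continuous_coord i.1).comp continuous_subtype_val).continuousOn

theorem contractibleSpace_full (A : Set ι) [ContractibleSpace (Realization (C.induce A))] :
    ContractibleSpace (full C A) :=
  (induceHomeomorph C A).symm.contractibleSpace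

end Realization

/-! ### Quillen's fibre lemma and subdivision invariance -/

section Poset

open Realization

variable {P Q : Type*} [PartialOrder P] [PartialOrder Q]

theorem posetRealizationMap_comp {R : Type*} [PartialOrder R] (g : Q →o R) (f : P →o Q) :
    (posetRealizationMap g).comp (posetRealizationMap f) = posetRealizationMap (g.comp f) :=
  map_comp (isSimplicialMap_of_monotone f f.monotone) (isSimplicialMap_of_monotone g g.monotone)
    (isSimplicialMap_of_monotone (g.comp f) (g.comp f).monotone)

theorem posetRealizationMap_id :
    posetRealizationMap (OrderHom.id : P →o P) = ContinuousMap.id _ :=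
  map_id (isSimplicialMap_of_monotone _ (OrderHom.id : P →o P).monotone)

theorem posetRealizationMap_const (a : Q) :
    posetRealizationMap (OrderHom.const P a) = ContinuousMap.const _ (vertex _ a) := by
  classical
  ext x : 1
  refine eq_of_mem_face_singleton (p := a) ?_ (vertex_mem_face (Finset.mem_singleton_self a))
  have h := map_mem_face (isSimplicialMap_of_monotone _ (OrderHom.const P a).monotone)
    x.mem_face_support
  refine face_mono (fun i hi => ?_) h
  obtain ⟨_, -, rfl⟩ := Finset.mem_image.1 hi
  exact Finset.mem_singleton_self _

/-- A conically contractible poset is contractible. -/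
theorem contractibleSpace_of_conical (f : P →o P) (a : P) (h1 : ∀ p, p ≤ f p)
    (h2 : ∀ p, a ≤ f p) : ContractibleSpace (Realization (orderComplex P)) := by
  refine (contractible_iff_id_nullhomotopic _).2 ⟨vertex _ a, ?_⟩
  rw [← posetRealizationMap_id, ← posetRealizationMap_const]
  -- The zigzag is $\mathrm{id}\le f\ge a$.
  exact (posetRealizationMap_homotopic_of_le (f := OrderHom.id) (g := f) h1).trans
    (posetRealizationMap_homotopic_of_le (f := OrderHom.const P a) (g := f) h2).symm

/-- The identity of $|P|$ factors through a contractible space. -/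
theorem contractibleSpace_of_retract (i : P →o Q) (r : Q →o P) (h : ∀ p, r (i p) = p)
    [ContractibleSpace (Realization (orderComplex Q))] :
    ContractibleSpace (Realization (orderComplex P)) := by
  refine (contractible_iff_id_nullhomotopic _).2 ?_
  have hri : r.comp i = OrderHom.id := OrderHom.ext _ _ (funext h)
  have := ((id_nullhomotopic (Realization (orderComplex Q))).comp_left
    (posetRealizationMap i)).comp_right (posetRealizationMap r)
  rwa [ContinuousMap.id_comp, posetRealizationMap_comp, hri, posetRealizationMap_id] at this

theorem contractibleSpace_full_orderComplex (A : Set P)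
    [h : ContractibleSpace (Realization (orderComplex A))] :
    ContractibleSpace (full (orderComplex P) A) := by
  rw [← orderComplex_induce] at h
  exact contractibleSpace_full A

instance contractibleSpace_full_Iic (p : P) :
    ContractibleSpace (full (orderComplex P) (Iic p)) := by
  have : ContractibleSpace (Realization (orderComplex (Iic p))) :=
    contractibleSpace_of_conical (OrderHom.const _ ⟨p, le_rfl⟩) ⟨p, le_rfl⟩ (fun q => q.2)
      fun _ => le_rfl
  exact contractibleSpace_full_orderComplex _

theorem mem_full_Iic_top (x : Realization (orderComplex P)) :
    x ∈ full (orderComplex P) (Iic x.top) := fun _ => le_top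

/-- Quillen's fibre lemma. -/
theorem isHomotopyEquivalence_of_contractible_fibers (f : P →o Q)
    (h : ∀ q, ContractibleSpace (Realization (orderComplex {p | f p ≤ q}))) :
    IsHomotopyEquivalence (posetRealizationMap f) := by
  classical
  let F : Q → Set (Realization (orderComplex P)) := fun q => full _ {p | f p ≤ q}
  have hF : Monotone F := fun a b hab => full_mono fun p hp => le_trans hp hab
  have hFc : ∀ q, ContractibleSpace (F q) := fun q =>
    have := h q
    contractibleSpace_full_orderComplex _
  -- The homotopy inverse is any map carried by the fibres: $g\circ f$ and the identity share the
  -- carrier $F(f(p))$, while $f\circ g$ and the identity share $|Q_{\le q}|$.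
  obtain ⟨g, hg⟩ := exists_carried_map hF
  refine ⟨⟨posetRealizationMap f, g, ?_, ?_⟩, rfl⟩
  · refine homotopic_of_contractible_carrier (F := fun p => F (f p))
      (hF.comp f.monotone) _ _ (fun x => ?_) fun x i hi => f.monotone (le_top hi)
    exact (congrArg F (top_posetRealizationMap f x)).subset (hg _)
  · refine homotopic_of_contractible_carrier (F := fun q => full (orderComplex Q) (Iic q))
      (fun a b hab => full_mono (Iic_subset_Iic.2 hab)) _ _ (fun x i hi => ?_) mem_full_Iic_top
    obtain ⟨p, hp, rfl⟩ := Finset.mem_image.1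
      ((support_map (isSimplicialMap_of_monotone f f.monotone) (g x)).subset hi)
    exact hg x p hp

/-- A simplicial complex is homotopy equivalent to its barycentric subdivision. -/
theorem homotopyEquivalent_barycentricSubdivision {ι : Type*} (C : AbstractSimplicialComplex ι) :
    HomotopyEquivalent (Realization C) (Realization (barycentricSubdivision C)) := by
  classical
  let v : SimplexPoset C → ι := fun s => (C.nonempty_of_mem s.2).choose
  have hv : ∀ s, v s ∈ s.1 := fun s => (C.nonempty_of_mem s.2).choose_spec
  have h := isSimplicialMap_vertex_choice v hv
  refine ⟨⟨toSubdivision C, map v h, map_comp_toSubdivision_homotopic v hv h, ?_⟩⟩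
  -- Both maps send a point with top simplex `s` into the subdivision of `s`, a cone.
  refine homotopic_of_contractible_carrier
    (F := fun s => full (barycentricSubdivision C) (Iic s))
    (fun a b hab => full_mono (Iic_subset_Iic.2 hab)) _ _ (fun x s hs => ?_) mem_full_Iic_top
  refine subset_of_mem_support_toSubdivision (fun i hi => ?_) hs
  obtain ⟨t, ht, rfl⟩ := Finset.mem_image.1 ((support_map h x).subset hi)
  exact le_top ht (hv t)

/-- This poset is that of the simplices of the full subcomplex on `A`, whose order complex is a
subdivision. It turns fibres over $J(V)$ into full subcomplexes. -/
theorem contractibleSpace_simplices_subset {ι : Type*} (C : AbstractSimplicialComplex ι)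
    (A : Set ι) [ContractibleSpace (Realization (C.induce A))] :
    ContractibleSpace (Realization (orderComplex {c : SimplexPoset C | ∀ i ∈ c.1, i ∈ A})) := by
  classical
  obtain ⟨e⟩ := homotopyEquivalent_barycentricSubdivision (C.induce A)
  have : ContractibleSpace (Realization (barycentricSubdivision (C.induce A))) :=
    e.symm.contractibleSpace
  refine contractibleSpace_of_retract (Q := SimplexPoset (C.induce A))
    ⟨fun c => ⟨c.1.1.subtype (· ∈ A), ?_⟩, fun c d h => ?_⟩
    ⟨fun c => ⟨⟨c.1.map (Function.Embedding.subtype _), c.2⟩, fun i hi => ?_⟩, fun c d h => ?_⟩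
    fun c => ?_
  · rw [AbstractSimplicialComplex.mem_induce, Finset.subtype_map_of_mem c.2]
    exact c.1.2
  · exact Finset.subtype_mono h
  · obtain ⟨a, -, rfl⟩ := Finset.mem_map.1 hi
    exact a.2
  · exact Finset.map_subset_map.2 h
  · exact Subtype.ext (Subtype.ext (Finset.subtype_map_of_mem c.2))

end Poset

/-! ### Fibres over the proper layers -/

section Buildings

variable {K V : Type*} [Field K] [AddCommGroup V] [Module K V]

/-- Take a finite generating set of the lower space. If the upper space is $V$, delete $0$: the
lower space is then non-zero, so something remains. Otherwise add $0$, which ensures non-emptiness.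
-/
theorem ProperLayer.exists_spanning_simplex [FiniteDimensional K V] (q : ProperLayer K V) :
    ∃ X : Finset V, Submodule.span K (X : Set V) = q.lower ∧ X.Nonempty ∧
      (0 ∈ X → q.upper < ⊤) := by
  classical
  obtain ⟨S, hS⟩ := IsNoetherian.noetherian q.lower
  by_cases h : q.upper = ⊤
  · have hspan : Submodule.span K (S.erase 0 : Set V) = q.lower := by
      rw [Finset.coe_erase, Submodule.span_sdiff_singleton_zero, hS]
    refine ⟨S.erase 0, by simpa using hspan, ?_, by simp⟩
    rw [Finset.nonempty_iff_ne_empty]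
    intro he
    rw [he, Finset.coe_empty, Submodule.span_empty] at hspan
    exact q.proper ⟨hspan.symm, h⟩
  · refine ⟨insert 0 S, ?_, Finset.insert_nonempty _ _, fun _ => Ne.lt_top h⟩
    rw [Finset.coe_insert, Submodule.span_insert_zero, hS]

variable [Nontrivial V]

/-- The fibre condition is a condition on each vertex of the chain, so the fibre comes from a full
subcomplex. -/
theorem layerMap_le_iff (c : SimplexPoset (barycentricSubdivision (EStar K V)))
    (q : ProperLayer K V) :
    layerMap K V c ≤ q ↔ ∀ X ∈ c.1, q.lower ≤ simplexSpan X ∧ simplexSpan X ≤ q.upper := by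
  constructor
  · intro h X hX
    exact ⟨h.1.trans (simplexSpan_mono (chainMin_le c hX)),
      (simplexSpan_mono (le_chainMax c hX)).trans h.2⟩
  · intro h
    exact ⟨(h _ (chainMin_mem c)).1, (h _ (chainMax_mem c)).2⟩

/-- Conical contraction $X\subseteq X\cup Y\supseteq Y$ with $Y$ spanning the lower space: the union
has the same span as $X$, and if $0\in Y$ that span is proper because the upper space is. -/
theorem contractibleSpace_simplices_span_mem [FiniteDimensional K V] (q : ProperLayer K V) :
    ContractibleSpace (Realization (orderComplex
      {X : SimplexPoset (EStar K V) | q.lower ≤ simplexSpan X ∧ simplexSpan X ≤ q.upper})) := by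
  classical
  obtain ⟨Y, hY, hYne, hY0⟩ := q.exists_spanning_simplex
  have hspan : ∀ X : SimplexPoset (EStar K V),
      Submodule.span K ((X.1 ∪ Y : Finset V) : Set V) = simplexSpan X ⊔ q.lower := fun X => by
    rw [Finset.coe_union, Submodule.span_union, hY]
    rfl
  have hY' : Y ∈ EStar K V := ⟨hYne, fun h0 => by
    rw [hY]
    exact q.lower_le_upper.trans_lt (hY0 h0)⟩
  have hunion : ∀ X : SimplexPoset (EStar K V), q.lower ≤ simplexSpan X →
      simplexSpan X ≤ q.upper → X.1 ∪ Y ∈ EStar K V := fun X h1 h2 =>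
    ⟨hYne.mono Finset.subset_union_right, fun h0 => by
      rw [hspan, sup_eq_left.2 h1]
      rcases Finset.mem_union.1 h0 with h | h
      · exact X.2.2 h
      · exact h2.trans_lt (hY0 h)⟩
  refine contractibleSpace_of_conical
    ⟨fun X => ⟨⟨X.1.1 ∪ Y, hunion X.1 X.2.1 X.2.2⟩, ?_⟩,
      fun X X' h => Finset.union_subset_union_left h⟩
    ⟨⟨Y, hY'⟩, hY.ge, hY.le.trans q.lower_le_upper⟩
    (fun X => Finset.subset_union_left) fun X => Finset.subset_union_right
  have h : simplexSpan ⟨X.1.1 ∪ Y, hunion X.1 X.2.1 X.2.2⟩ = simplexSpan X.1 :=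
    (hspan X.1).trans (sup_eq_left.2 X.2.1)
  exact ⟨X.2.1.trans h.ge, h.le.trans X.2.2⟩

theorem isHomotopyEquivalence_layerMap [FiniteDimensional K V] :
    IsHomotopyEquivalence (posetRealizationMap (layerMap K V)) := by
  refine isHomotopyEquivalence_of_contractible_fibers _ fun q => ?_
  have := contractibleSpace_simplices_span_mem q
  rw [← orderComplex_induce] at this
  have hset : {c | layerMap K V c ≤ q} =
      {c | ∀ X ∈ c.1, q.lower ≤ simplexSpan X ∧ simplexSpan X ≤ q.upper} :=
    Set.ext fun c => layerMap_le_iff c q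
  rw [hset]
  exact contractibleSpace_simplices_subset (barycentricSubdivision (EStar K V))
    {X | q.lower ≤ simplexSpan X ∧ simplexSpan X ≤ q.upper}

theorem mem_orderComplex_of_mem_suspendedTitsBuilding {c : Finset (Submodule K V)}
    (hc : c ∈ suspendedTitsBuilding K V) : c ∈ orderComplex (Submodule K V) :=
  ⟨hc.1, hc.2.1⟩

/-- The map `(W₀ < ⋯ < W_p) ↦ (W₀, W_p)` from flags to proper layers. -/
def flagMap (K V : Type*) [Field K] [AddCommGroup V] [Module K V] [Nontrivial V] :
    SimplexPoset (suspendedTitsBuilding K V) →o ProperLayer K V where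
  toFun c :=
    { lower := chainMin ⟨c.1, mem_orderComplex_of_mem_suspendedTitsBuilding c.2⟩
      upper := chainMax ⟨c.1, mem_orderComplex_of_mem_suspendedTitsBuilding c.2⟩
      lower_le_upper := chainMin_le _ (chainMax_mem _)
      proper := by
        rintro ⟨h0, h1⟩
        rcases c.2.2.2 with h | h
        · exact (h _ (chainMin_mem _)).ne' h0
        · exact (h _ (chainMax_mem _)).ne h1 }
  monotone' a b hab := ⟨chainMin_le _ (hab (chainMin_mem _)), le_chainMax _ (hab (chainMax_mem _))⟩

theorem flagMap_le_iff (c : SimplexPoset (suspendedTitsBuilding K V)) (q : ProperLayer K V) :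
    flagMap K V c ≤ q ↔ ∀ W ∈ c.1, W ∈ Icc q.lower q.upper := by
  constructor
  · intro h W hW
    exact ⟨h.1.trans (chainMin_le ⟨c.1, mem_orderComplex_of_mem_suspendedTitsBuilding c.2⟩ hW),
      (le_chainMax ⟨c.1, mem_orderComplex_of_mem_suspendedTitsBuilding c.2⟩ hW).trans h.2⟩
  · intro h
    exact ⟨(h _ (chainMin_mem _)).1, (h _ (chainMax_mem _)).2⟩

/-- The interval of a proper layer misses $0$ or $V$, so the extra condition on flags is automatic.
-/
theorem suspendedTitsBuilding_induce_Icc (q : ProperLayer K V) :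
    (suspendedTitsBuilding K V).induce (Icc q.lower q.upper) =
      orderComplex (Icc q.lower q.upper) := by
  refine SetLike.ext fun s => and_congr Finset.map_nonempty ?_
  refine (and_iff_left ?_).trans isChain_map_subtype
  simp only [Finset.mem_map, Function.Embedding.subtype_apply]
  by_cases h : q.lower = ⊥
  · right
    rintro _ ⟨W, -, rfl⟩
    exact W.2.2.trans_lt (Ne.lt_top fun h1 => q.proper ⟨h, h1⟩)
  · left
    rintro _ ⟨W, -, rfl⟩
    exact (bot_lt_iff_ne_bot.2 h).trans_le W.2.1

theorem isHomotopyEquivalence_flagMap :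
    IsHomotopyEquivalence (posetRealizationMap (flagMap K V)) := by
  refine isHomotopyEquivalence_of_contractible_fibers _ fun q => ?_
  have : ContractibleSpace (Realization (orderComplex (Icc q.lower q.upper))) :=
    contractibleSpace_of_conical OrderHom.id ⟨q.lower, le_rfl, q.lower_le_upper⟩
      (fun _ => le_rfl) fun W => W.2.1
  rw [← suspendedTitsBuilding_induce_Icc] at this
  have hset : {c | flagMap K V c ≤ q} = {c | ∀ W ∈ c.1, W ∈ Icc q.lower q.upper} :=
    Set.ext fun c => flagMap_le_iff c q
  rw [hset]
  exact contractibleSpace_simplices_subset (suspendedTitsBuilding K V) (Icc q.lower q.upper)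

end Buildings
end

theorem mainTheorem5 {K V : Type*} [Field K] [AddCommGroup V] [Module K V]
    [FiniteDimensional K V] [Nontrivial V] :
    HomotopyEquivalent (Realization (EStar K V)) (Realization (suspendedTitsBuilding K V)) ∧
    HomotopyEquivalent (Realization (EStar K V))
      (Realization (orderComplex (ProperLayer K V))) ∧
    IsHomotopyEquivalence (posetRealizationMap (layerMap K V)) := by
  obtain ⟨e, -⟩ := isHomotopyEquivalence_layerMap (K := K) (V := V)
  obtain ⟨f, -⟩ := isHomotopyEquivalence_flagMap (K := K) (V := V)
  obtain ⟨s₁⟩ := homotopyEquivalent_barycentricSubdivision (EStar K V)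
  obtain ⟨s₂⟩ := homotopyEquivalent_barycentricSubdivision (barycentricSubdivision (EStar K V))
  obtain ⟨s₃⟩ := homotopyEquivalent_barycentricSubdivision (suspendedTitsBuilding K V)
  -- `layerMap` starts from the simplices of $\mathrm{sd}\,E^*(V)$, so two subdivisions are needed;
  -- `flagMap` needs only one.
  have g := (s₁.trans s₂).trans e
  exact ⟨⟨g.trans (s₃.trans f).symm⟩, ⟨g⟩, isHomotopyEquivalence_layerMap⟩
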